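/- **Types.** Fix disjoint countably infinite sets of datatype variables $\alpha$, of type variables $X$, and of constants $c$; $V,W$ range over all variables and $a$ over variables and constants. Datatypes $D$ and types $A$ are given by $$D ::= \alpha \mid c \mid D\mathbin{@}A \mid D\oplus D\mid \mu\alpha.D,\qquad A ::= X\mid D\mid A\supset A\mid A\oplus A\mid \mu X.A,$$ up to renaming of bound variables, and every subexpression $\mu V.A$ is required to be contractive: $V$ occurs free in $A$ only under $@$ or $\supset$, if at all. These are the (contractive) $\mu$-types. **Equivalence** $\simeq_\mu$ is the least equivalence relation on $\mu$-types that is a congruence for $@$ (on datatypes to the left of $@$), $\supset$, $\oplus$ and $\mu V$, makes $\oplus$ associative, commutative and idempotent, and satisfies $\mu V.A\simeq_\mu A\{V:=\mu V.A\}$ and: if $A\simeq_\mu B\{V:=A\}$ and $\mu V.B$ is contractive, then $A\simeq_\mu\mu V.B$ (where $A$ is a datatype if $V$ is a datatype variable). **Subtyping** $\Sigma\vdash A\preceq_\mu B$, where $\Sigma$ is a set of assumptions $V\preceq W$ between variables, is defined inductively by: reflexivity; transitivity; $\Sigma\vdash V\preceq_\mu W$ if $(V\preceq W)\in\Sigma$;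 $\Sigma\vdash A\preceq_\mu B$ if $A\simeq_\mu B$; covariance of $@$ in both arguments (datatypes on the left of $@$); $\supset$ contravariant in its first and covariant in its second argument; $\Sigma\vdash A\oplus B\preceq_\mu C$ from $\Sigma\vdash A\preceq_\mu C$ and $\Sigma\vdash B\preceq_\mu C$; $\Sigma\vdash A\preceq_\mu B\oplus C$ from $\Sigma\vdash A\preceq_\mu B$ or from $\Sigma\vdash A\preceq_\mu C$; and $\Sigma\vdash \mu V.A\preceq_\mu\mu W.B$ from $\Sigma,V\preceq W\vdash A\preceq_\mu B$, provided that $W$ is not free in $A$, $V$ is not free in $B$, and neither $V$ nor $W$ occurs in $\Sigma$. Write $A\preceq_\mu B$ for $\varnothing\vdash A\preceq_\mu B$. **Trees.** For a $\mu$-type $A$ let $[\![A]\!]$ be its complete unfolding: the possibly infinite tree over the nullary symbols $a$ and the binary symbols $@,\supset,\oplus$ with $[\![a]\!]=a$, $[\![A_1\star A_2]\!]=[\![A_1]\!]\star[\![A_2]\!]$ for $\star\in\{@,\supset,\oplus\}$, and $[\![\mu V.A]\!]=[\![A\{V:=\mu V.A\}]\!]$. It has no branch ending in infinitely many consecutive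 $\oplus$. For such a tree $T$ let $[\![T]\!]^{\mathfrak n}$ be the tree in which each maximal union, with non-union components $T_1,\dots,T_n$ ($n>1$) from left to right, is replaced by one node $\oplus^n$ whose children are $[\![T_1]\!]^{\mathfrak n},\dots,[\![T_n]\!]^{\mathfrak n}$, all other nodes being kept. **Subtyping up to $\mathcal R$.** Let $\mathcal R$ be a set of pairs of trees over the symbols $a,@,\supset$ and $\oplus^n$ ($n>1$). The relation $\preceq_{\mathcal R}$ is the greatest relation $S$ on such trees for which every pair in $S$ is the conclusion of an instance of one of the following rules, whose premises $\mathbb A\le\mathbb B$ mean $(\mathbb A,\mathbb B)\in S\cup\mathcal R$: 1. $a\preceq_{\mathcal R} a$; 2. $\mathbb D\mathbin@\mathbb A\preceq_{\mathcal R}\mathbb D'\mathbin@\mathbb A'$ if $\mathbb D\le\mathbb D'$ and $\mathbb A\le\mathbb A'$; 3. $\mathbb A\supset\mathbb B\preceq_{\mathcal R}\mathbb A'\supset\mathbb B'$ if $\mathbb A'\le\mathbb A$ and $\mathbb B\le\mathbb B'$; 4. $\oplus^n(\mathbb A_1,\dots,\mathbb A_n)\preceq_{\mathcal R}\oplus^m(\mathbb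 B_1,\dots,\mathbb B_m)$ if there is $f:\{1,\dots,n\}\to\{1,\dots,m\}$ with $\mathbb A_i\le\mathbb B_{f(i)}$ for all $i$; 5. $\oplus^n(\mathbb A_1,\dots,\mathbb A_n)\preceq_{\mathcal R}\mathbb B$ if $\mathbb A_i\le\mathbb B$ for all $i$, where the root of $\mathbb B$ is not a union; 6. $\mathbb A\preceq_{\mathcal R}\oplus^m(\mathbb B_1,\dots,\mathbb B_m)$ if $\mathbb A\le\mathbb B_k$ for some $k$, where the root of $\mathbb A$ is not a union; in rules 4–6 the roots of all $\mathbb A_i$ and $\mathbb B_j$ are required not to be unions. **Proposition.** For all contractive $\mu$-types $A$ and $B$, $$A\preceq_\mu B\quad\Longleftrightarrow\quad [\![[\![A]\!]]\!]^{\mathfrak n}\ \preceq_{\varnothing}\ [\![[\![B]\!]]\!]^{\mathfrak n}.$$ -/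

import Mathlib

namespace MuTypes

/-! ### Syntax of types -/

/-- The two sorts of typing expressions: datatypes and (arbitrary) types. -/
inductive Kind where
  | data
  | type
  deriving DecidableEq

/-- Variables: countably many datatype variables and countably many type variables. -/
structure TVar where
  kind : Kind
  idx : ℕ
  deriving DecidableEq

/-- Raw type expressions, up to renaming of bound variables: free variables are named, a variable
bound by `mu` is a de Bruijn index (`bvar 0` refers to the innermost enclosing `mu`).
`mu k A` binds a variable of sort `k`. -/
inductive PreType where
  | bvar : ℕ → PreType
  | fvar : TVar → PreType
  | const : ℕ → PreType
  | app : PreType → PreType → PreType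
  | arr : PreType → PreType → PreType
  | union : PreType → PreType → PreType
  | mu : Kind → PreType → PreType

namespace PreType

/-- `openAt n U A` replaces by `U` the variable that is bound `n` binders outside of `A`.
It is only used for `U` without dangling indices. -/
def openAt : ℕ → PreType → PreType → PreType
  | n, U, bvar i => if i = n then U else bvar i
  | _, _, fvar V => fvar V
  | _, _, const c => const c
  | n, U, app A B => app (openAt n U A) (openAt n U B)
  | n, U, arr A B => arr (openAt n U A) (openAt n U B)
  | n, U, union A B => union (openAt n U A) (openAt n U B)
  | n, U, mu k A => mu k (openAt (n + 1) U A)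

/-- If `A` is the body of `mu k A`, read as `μV.A`, then `A.inst U` is `A` with `U` for `V`. -/
def inst (A U : PreType) : PreType := openAt 0 U A

/-- Free variables. -/
def fv : PreType → Finset TVar
  | bvar _ => ∅
  | fvar V => {V}
  | const _ => ∅
  | app A B => fv A ∪ fv B
  | arr A B => fv A ∪ fv B
  | union A B => fv A ∪ fv B
  | mu _ A => fv A

/-- The variable bound `n` binders outside occurs only under `app` or `arr`, if at all. -/
def Guarded : ℕ → PreType → Prop
  | n, bvar i => i ≠ n
  | _, fvar _ => True
  | _, const _ => True
  | _, app _ _ => True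
  | _, arr _ _ => True
  | n, union A B => Guarded n A ∧ Guarded n B
  | n, mu _ A => Guarded (n + 1) A

end PreType

open PreType

/-- `HasKind Γ .data D` and `HasKind Γ .type A` say that `D` is a contractive `μ`-datatype and
that `A` is a contractive `μ`-type, where `Γ` lists the sorts of the enclosing binders. -/
inductive HasKind : List Kind → Kind → PreType → Prop
  | bvar {Γ k i} : Γ[i]? = some k → HasKind Γ k (bvar i)
  | fvar {Γ} (V : TVar) : HasKind Γ V.kind (fvar V)
  | const {Γ} (c : ℕ) : HasKind Γ .data (const c)
  | app {Γ D A} : HasKind Γ .data D → HasKind Γ .type A → HasKind Γ .data (app D A)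
  | arr {Γ A B} : HasKind Γ .type A → HasKind Γ .type B → HasKind Γ .type (arr A B)
  | union {Γ k A B} : HasKind Γ k A → HasKind Γ k B → HasKind Γ k (union A B)
  | mu {Γ k A} : HasKind (k :: Γ) k A → Guarded 0 A → HasKind Γ k (mu k A)
  | ofData {Γ D} : HasKind Γ .data D → HasKind Γ .type D

/-- Contractive `μ`-datatypes. -/
abbrev IsDatatype (D : PreType) : Prop := HasKind [] .data D

/-- Contractive `μ`-types. -/
abbrev IsType (A : PreType) : Prop := HasKind [] .type A

/-- The set of contractive `μ`-types. -/
structure MuType where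
  val : PreType
  isType : IsType val

/-! ### Type equivalence and subtyping for `μ`-types -/

/-- Type equivalence. In `mu k A` the bound variable is named by opening the body `A` with a
variable that does not occur in it. -/
inductive TypeEq : PreType → PreType → Prop
  | refl {A} : IsType A → TypeEq A A
  | trans {A B C} : TypeEq A B → TypeEq B C → TypeEq A C
  | symm {A B} : TypeEq A B → TypeEq B A
  | comp {D D' A A'} : IsDatatype D → IsDatatype D' → TypeEq D D' → TypeEq A A' →
      TypeEq (app D A) (app D' A')
  | func {A A' B B'} : TypeEq A A' → TypeEq B B' → TypeEq (arr A B) (arr A' B')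
  | union_idem {A} : IsType A → TypeEq (union A A) A
  | union_comm {A B} : IsType A → IsType B → TypeEq (union A B) (union B A)
  | union_assoc {A B C} : IsType A → IsType B → IsType C →
      TypeEq (union A (union B C)) (union (union A B) C)
  | union {A A' B B'} : TypeEq A A' → TypeEq B B' → TypeEq (union A B) (union A' B')
  | mu {A B} (V : TVar) : HasKind [] V.kind (mu V.kind A) → HasKind [] V.kind (mu V.kind B) →
      V ∉ A.fv → V ∉ B.fv → TypeEq (A.inst (fvar V)) (B.inst (fvar V)) →
      TypeEq (mu V.kind A) (mu V.kind B)
  | fold {k A} : HasKind [] k (mu k A) → TypeEq (mu k A) (A.inst (mu k A))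
  | contr {k A B} : HasKind [] k A → HasKind [] k (mu k B) → TypeEq A (B.inst A) →
      TypeEq A (mu k B)

/-- Subtyping `Σ ⊢ A ≤ B` under assumptions `(V, W) ∈ Σ`, read `V ≤ W`. In rule `mu` the bound
variables are named `V` and `W`; as names of bound variables they are fresh for the bodies that
they bind in and for the assumptions already made. -/
inductive Sub : Set (TVar × TVar) → PreType → PreType → Prop
  | refl {S A} : IsType A → Sub S A A
  | hyp {S V W} : (V, W) ∈ S → Sub S (fvar V) (fvar W)
  | eq {S A B} : TypeEq A B → Sub S A B
  | trans {S A B C} : Sub S A B → Sub S B C → Sub S A C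
  | comp {S D D' A A'} : IsDatatype D → IsDatatype D' → Sub S D D' → Sub S A A' →
      Sub S (app D A) (app D' A')
  | func {S A A' B B'} : Sub S A A' → Sub S B B' → Sub S (arr A' B) (arr A B')
  | union_l {S A B C} : Sub S A C → Sub S B C → Sub S (union A B) C
  | union_r1 {S A B C} : IsType C → Sub S A B → Sub S A (union B C)
  | union_r2 {S A B C} : IsType B → Sub S A C → Sub S A (union B C)
  | mu {S A B} (V W : TVar) :
      HasKind [] V.kind (mu V.kind A) → HasKind [] W.kind (mu W.kind B) →
      V ∉ A.fv → W ∉ B.fv →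
      (∀ p ∈ S, p.1 ≠ V ∧ p.2 ≠ V ∧ p.1 ≠ W ∧ p.2 ≠ W) →
      W ∉ (A.inst (fvar V)).fv → V ∉ (B.inst (fvar W)).fv →
      Sub (insert (V, W) S) (A.inst (fvar V)) (B.inst (fvar W)) →
      Sub S (mu V.kind A) (mu W.kind B)

/-- Subtyping of `μ`-types: derivability without assumptions. -/
def MuType.Subtype (A B : MuType) : Prop := Sub ∅ A.val B.val

/-! ### Infinite types over binary unions -/

/-- Nullary symbols of the tree alphabets: variables and constants. -/
abbrev Atom : Type := TVar ⊕ ℕ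

/-- The ranked alphabet with binary unions. -/
inductive Sym where
  | atom (a : Atom)
  | app
  | arr
  | union

abbrev Sym.arity : Sym → ℕ
  | atom _ => 0
  | app => 2
  | arr => 2
  | union => 2

/-- The polynomial functor whose M-type consists of the possibly infinite trees over `Sym`. -/
def Sig : PFunctor.{0, 0} := ⟨Sym, fun s => Fin s.arity⟩

/-- `s` is an immediate subtree of `t`. -/
def Child (s t : Sig.M) : Prop := ∃ i, t.dest.2 i = s

/-- `t` has a union at its root and `s` is an immediate subtree of it. -/
def UnionChild (s t : Sig.M) : Prop := t.dest.1 = Sym.union ∧ Child s t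

/-- No branch of `t` ends in infinitely many consecutive unions. -/
def NoUnionBranch (t : Sig.M) : Prop :=
  ¬ ∃ f : ℕ → Sig.M, Relation.ReflTransGen Child (f 0) t ∧ ∀ n, UnionChild (f (n + 1)) (f n)

/-- Infinite types: possibly infinite trees without infinite branches of unions. -/
structure Tree where
  val : Sig.M
  noUnionBranch : NoUnionBranch val

theorem child_iff {s t : Sig.M} {a : Sym} {c : Fin a.arity → Sig.M} (h : t.dest = ⟨a, c⟩) :
    Child s t ↔ ∃ i, c i = s := by
  unfold Child
  rw [h]
  rfl

theorem unionChild_iff {s t : Sig.M} {a : Sym} {c : Fin a.arity → Sig.M} (h : t.dest = ⟨a, c⟩) :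
    UnionChild s t ↔ a = Sym.union ∧ ∃ i, c i = s := by
  unfold UnionChild
  rw [child_iff h, h]
  exact Iff.rfl

theorem NoUnionBranch.child {s t : Sig.M} (ht : NoUnionBranch t) (h : Child s t) :
    NoUnionBranch s :=
  fun ⟨f, h0, hf⟩ => ht ⟨f, h0.tail h, hf⟩

theorem NoUnionBranch.acc {t : Sig.M} (ht : NoUnionBranch t) : Acc UnionChild t := by
  rw [acc_iff_isEmpty_descending_chain]
  exact ⟨fun ⟨f, h0, hf⟩ => ht ⟨f, by rw [h0], hf⟩⟩

/-- The root symbol of an infinite type together with its immediate subtrees. -/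
def Tree.dest (t : Tree) : Sig Tree :=
  ⟨t.1.dest.1, fun i => ⟨t.1.dest.2 i, t.2.child ⟨i, rfl⟩⟩⟩

/-! ### Unfolding of `μ`-types -/

theorem HasKind.weaken {Γ k A} (h : HasKind Γ k A) (Δ : List Kind) : HasKind (Γ ++ Δ) k A := by
  induction h with
  | bvar h =>
    refine .bvar ?_
    rw [List.getElem?_append_left]
    · exact h
    · exact (List.getElem?_eq_some_iff.1 h).1
  | fvar V => exact .fvar V
  | const c => exact .const c
  | app _ _ h1 h2 => exact .app h1 h2
  | arr _ _ h1 h2 => exact .arr h1 h2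
  | union _ _ h1 h2 => exact .union h1 h2
  | mu _ g h1 => exact .mu h1 g
  | ofData _ h1 => exact .ofData h1

theorem HasKind.guarded {Γ k A} (h : HasKind Γ k A) : ∀ n, Γ.length ≤ n → Guarded n A := by
  induction h with
  | bvar h =>
    intro n hn
    have := (List.getElem?_eq_some_iff.1 h).1
    simp only [Guarded]
    omega
  | fvar V => intros; trivial
  | const c => intros; trivial
  | app _ _ h1 h2 => intros; trivial
  | arr _ _ h1 h2 => intros; trivial
  | union _ _ h1 h2 => exact fun n hn => ⟨h1 n hn, h2 n hn⟩
  | mu _ g h1 => exact fun n hn => h1 (n + 1) (by simpa using hn)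
  | ofData _ h1 => exact h1

theorem guarded_openAt {U : PreType} (hU : ∀ n, Guarded n U) (A : PreType) :
    ∀ i n, Guarded i A → Guarded i (openAt n U A) := by
  induction A with
  | bvar j =>
    intro i n h
    simp only [openAt]
    split
    · exact hU i
    · exact h
  | fvar V => intros; trivial
  | const c => intros; trivial
  | app _ _ h1 h2 => intros; trivial
  | arr _ _ h1 h2 => intros; trivial
  | union _ _ h1 h2 => exact fun i n h => ⟨h1 i n h.1, h2 i n h.2⟩
  | mu k A h1 => exact fun i n h => h1 (i + 1) (n + 1) h

theorem HasKind.openAt {Δ j A} (h : HasKind Δ j A) {k U} (hU : HasKind [] k U) :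
    ∀ Γ, Δ = Γ ++ [k] → HasKind Γ j (openAt Γ.length U A) := by
  induction h with
  | @bvar Δ j i h =>
    rintro Γ rfl
    simp only [PreType.openAt]
    split
    · next e =>
      subst e
      simp only [List.getElem?_concat_length, Option.some.injEq] at h
      subst h
      exact hU.weaken Γ
    · next e =>
      refine .bvar ?_
      have h1 := (List.getElem?_eq_some_iff.1 h).1
      simp only [List.length_append, List.length_cons, List.length_nil] at h1
      rwa [List.getElem?_append_left (by omega)] at h
  | fvar V => exact fun _ _ => .fvar V
  | const c => exact fun _ _ => .const c
  | app _ _ h1 h2 => exact fun Γ e => .app (h1 Γ e) (h2 Γ e)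
  | arr _ _ h1 h2 => exact fun Γ e => .arr (h1 Γ e) (h2 Γ e)
  | union _ _ h1 h2 => exact fun Γ e => .union (h1 Γ e) (h2 Γ e)
  | @mu Δ k' A _ g h1 =>
    exact fun Γ e => .mu (h1 (k' :: Γ) (by simp [e]))
      (guarded_openAt (fun n => hU.guarded n (Nat.zero_le n)) A _ _ g)
  | ofData _ h1 => exact fun Γ e => .ofData (h1 Γ e)

theorem HasKind.app_inv {Γ k D A} (h : HasKind Γ k (PreType.app D A)) :
    HasKind Γ .data D ∧ HasKind Γ .type A := by
  generalize e : PreType.app D A = T at h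
  induction h with
  | app h1 h2 => cases e; exact ⟨h1, h2⟩
  | ofData _ ih => exact ih e
  | _ => cases e

theorem HasKind.arr_inv {Γ k A B} (h : HasKind Γ k (PreType.arr A B)) :
    HasKind Γ .type A ∧ HasKind Γ .type B := by
  generalize e : PreType.arr A B = T at h
  induction h with
  | arr h1 h2 => cases e; exact ⟨h1, h2⟩
  | ofData _ ih => exact ih e
  | _ => cases e

theorem HasKind.toType {Γ k A} (h : HasKind Γ k A) : HasKind Γ .type A := by
  cases k
  · exact .ofData h
  · exact h

theorem HasKind.union_inv {Γ k A B} (h : HasKind Γ k (PreType.union A B)) :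
    HasKind Γ .type A ∧ HasKind Γ .type B := by
  generalize e : PreType.union A B = T at h
  induction h with
  | union h1 h2 => cases e; exact ⟨h1.toType, h2.toType⟩
  | ofData _ ih => exact ih e
  | _ => cases e

theorem HasKind.mu_inv {Γ j k A} (h : HasKind Γ j (PreType.mu k A)) :
    HasKind (k :: Γ) k A ∧ Guarded 0 A := by
  generalize e : PreType.mu k A = T at h
  induction h with
  | mu h1 g => cases e; exact ⟨h1, g⟩
  | ofData _ ih => exact ih e
  | _ => cases e

theorem HasKind.inst_mu {j k A} (h : HasKind [] j (PreType.mu k A)) :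
    HasKind [] .type (A.inst (PreType.mu k A)) :=
  (h.mu_inv.1.openAt (.mu h.mu_inv.1 h.mu_inv.2) [] rfl).toType

theorem not_isType_bvar {i : ℕ} : ¬ IsType (bvar i) := by
  intro h
  unfold IsType at h
  generalize e : PreType.bvar i = T at h
  generalize hk : Kind.type = k at h
  generalize hΓ : ([] : List Kind) = Γ at h
  clear hk
  induction h with
  | bvar h => subst hΓ; simp at h
  | ofData _ ih => exact ih e hΓ
  | _ => cases e

/-- The number of nested `mu` and `union` at the root, which unfolding strictly decreases. -/
def PreType.topDepth : PreType → ℕ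
  | bvar _ => 0
  | fvar _ => 0
  | const _ => 0
  | app _ _ => 0
  | arr _ _ => 0
  | union A B => max (topDepth A) (topDepth B) + 1
  | mu _ A => topDepth A + 1

theorem topDepth_openAt (U A : PreType) :
    ∀ n, Guarded n A → topDepth (openAt n U A) = topDepth A := by
  induction A with
  | bvar i => intro n h; simp only [Guarded] at h; simp [openAt, h]
  | fvar V => intros; rfl
  | const c => intros; rfl
  | app _ _ h1 h2 => intros; rfl
  | arr _ _ h1 h2 => intros; rfl
  | union _ _ h1 h2 => intro n h; simp only [openAt, topDepth, h1 n h.1, h2 n h.2]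
  | mu k A h1 => intro n h; simp only [openAt, topDepth, h1 (n + 1) h]

/-- The root symbol and the immediate subterms of a contractive `μ`-type, after replacing `μV.A`
at the root by `A` with `μV.A` for `V` as long as possible. -/
def MuType.dest : MuType → Sig MuType
  | ⟨bvar _, h⟩ => absurd h not_isType_bvar
  | ⟨fvar V, _⟩ => ⟨Sym.atom (.inl V), Fin.elim0⟩
  | ⟨const c, _⟩ => ⟨Sym.atom (.inr c), Fin.elim0⟩
  | ⟨app D A, h⟩ => ⟨Sym.app, ![⟨D, .ofData h.app_inv.1⟩, ⟨A, h.app_inv.2⟩]⟩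
  | ⟨arr A B, h⟩ => ⟨Sym.arr, ![⟨A, h.arr_inv.1⟩, ⟨B, h.arr_inv.2⟩]⟩
  | ⟨union A B, h⟩ => ⟨Sym.union, ![⟨A, h.union_inv.1⟩, ⟨B, h.union_inv.2⟩]⟩
  | ⟨mu k A, h⟩ => MuType.dest ⟨A.inst (mu k A), h.inst_mu⟩
termination_by A => A.1.topDepth
decreasing_by
  have := topDepth_openAt (mu k A) A 0 h.mu_inv.2
  simp only [PreType.inst, this, PreType.topDepth]
  omega

/-- The complete unfolding of a `μ`-type, as a possibly infinite tree. -/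
def MuType.unfoldM : MuType → Sig.M := PFunctor.M.corec MuType.dest

theorem MuType.dest_unfoldM (A : MuType) :
    A.unfoldM.dest = ⟨A.dest.1, fun i => (A.dest.2 i).unfoldM⟩ :=
  PFunctor.M.dest_corec _ _

theorem MuType.unfoldM_mu {k A} (h : IsType (mu k A)) :
    MuType.unfoldM ⟨mu k A, h⟩ = MuType.unfoldM ⟨A.inst (mu k A), h.inst_mu⟩ := by
  unfold MuType.unfoldM
  rw [PFunctor.M.corec_def, PFunctor.M.corec_def, MuType.dest]

theorem MuType.acc_unfoldM (A : MuType) : Acc UnionChild A.unfoldM := by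
  obtain ⟨A, h⟩ := A
  induction hn : A.topDepth using Nat.strong_induction_on generalizing A with
  | _ n ih =>
    cases A with
    | mu k A =>
      rw [MuType.unfoldM_mu]
      have := topDepth_openAt (mu k A) A 0 h.mu_inv.2
      exact ih _ (by simp only [PreType.topDepth] at hn; omega) _ _ this
    | union A B =>
      refine ⟨_, fun s hs => ?_⟩
      simp only [PreType.topDepth] at hn
      have hd := MuType.dest_unfoldM ⟨PreType.union A B, h⟩
      rw [MuType.dest] at hd
      obtain ⟨-, i, rfl⟩ := (unionChild_iff hd).1 hs
      match i with
      | 0 => exact ih A.topDepth (by omega) _ h.union_inv.1 rfl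
      | 1 => exact ih B.topDepth (by omega) _ h.union_inv.2 rfl
    | bvar i => exact absurd h not_isType_bvar
    | _ =>
      refine ⟨_, fun s hs => ?_⟩
      have hd := MuType.dest_unfoldM ⟨_, h⟩
      rw [MuType.dest] at hd
      cases ((unionChild_iff hd).1 hs).1

theorem MuType.noUnionBranch_unfoldM (A : MuType) : NoUnionBranch A.unfoldM := by
  rintro ⟨f, h0, hf⟩
  have key : ∃ B : MuType, f 0 = B.unfoldM := by
    generalize f 0 = s at h0
    induction h0 using Relation.ReflTransGen.head_induction_on with
    | refl => exact ⟨A, rfl⟩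
    | head hc _ ih =>
      obtain ⟨B, rfl⟩ := ih
      obtain ⟨i, rfl⟩ := (child_iff B.dest_unfoldM).1 hc
      exact ⟨B.dest.2 i, rfl⟩
  obtain ⟨B, hB⟩ := key
  exact (acc_iff_isEmpty_descending_chain.1 B.acc_unfoldM).false ⟨f, hB, hf⟩

/-- The infinite type that a `μ`-type unfolds to. -/
def MuType.toTree (A : MuType) : Tree := ⟨A.unfoldM, A.noUnionBranch_unfoldM⟩

/-! ### Trees with `n`-ary unions -/

/-- The ranked alphabet with a union symbol of each arity `n > 1`. -/
inductive NSym where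
  | atom (a : Atom)
  | app
  | arr
  | union (n : ℕ) (hn : 1 < n)

abbrev NSym.arity : NSym → ℕ
  | atom _ => 0
  | app => 2
  | arr => 2
  | union n _ => n

def NSig : PFunctor.{0, 0} := ⟨NSym, fun s => Fin s.arity⟩

/-- Possibly infinite trees with `n`-ary unions. -/
abbrev NTree : Type := NSig.M

namespace NTree

def atom (a : Atom) : NTree := .mk ⟨NSym.atom a, Fin.elim0⟩
def app (D A : NTree) : NTree := .mk ⟨NSym.app, ![D, A]⟩
def arr (A B : NTree) : NTree := .mk ⟨NSym.arr, ![A, B]⟩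
def union (n : ℕ) (hn : 1 < n) (A : Fin n → NTree) : NTree := .mk ⟨NSym.union n hn, A⟩

/-- The root symbol is a union. -/
def IsUnion (t : NTree) : Prop := ∃ n hn, t.dest.1 = NSym.union n hn

end NTree

theorem Tree.wf_unionChild : WellFounded fun s t : Tree => UnionChild s.1 t.1 :=
  ⟨fun t => InvImage.accessible Tree.val t.2.acc⟩

instance : WellFoundedRelation Tree := ⟨_, Tree.wf_unionChild⟩

theorem Tree.unionChild_of_dest {t : Tree} {c : Fin 2 → Tree}
    (h : t.dest = ⟨Sym.union, c⟩) (i : Fin 2) : UnionChild (c i).1 t.1 := by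
  have h1 : t.1.dest = ⟨Sym.union, fun i => (c i).1⟩ :=
    congrArg (fun x : Sig Tree => (⟨x.1, fun i => (x.2 i).1⟩ : Sig Sig.M)) h
  exact (unionChild_iff h1).2 ⟨rfl, i, rfl⟩

/-- The components of an infinite type as a maximal union, from left to right: a tree whose root
is not a union is its own only component. -/
def Tree.components (t : Tree) : List Tree :=
  match _h : t.dest with
  | ⟨.union, c⟩ => components (c (0 : Fin 2)) ++ components (c (1 : Fin 2))
  | ⟨.atom _, _⟩ => [t]
  | ⟨.app, _⟩ => [t]
  | ⟨.arr, _⟩ => [t]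
termination_by t
decreasing_by
  · exact Tree.unionChild_of_dest _h 0
  · exact Tree.unionChild_of_dest _h 1

theorem Tree.components_pos (t : Tree) : 0 < t.components.length := by
  induction t using Tree.wf_unionChild.induction with
  | _ t ih =>
    rw [Tree.components]
    split
    · next c h =>
      have := ih _ (Tree.unionChild_of_dest h 0)
      rw [List.length_append]
      omega
    all_goals simp

theorem Tree.one_lt_components {t : Tree} {c : Fin 2 → Tree}
    (h : t.dest = ⟨Sym.union, c⟩) : 1 < t.components.length := by
  have h0 := (c 0).components_pos
  have h1 := (c 1).components_pos
  rw [Tree.components]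
  split
  · next c' h' =>
    rw [h] at h'
    cases h'
    rw [List.length_append]
    omega
  all_goals next h' => rw [h] at h'; cases h'

/-- The root of the translation to trees with `n`-ary unions, and the infinite types whose
translations are its immediate subtrees. -/
def Tree.ndest (t : Tree) : NSig Tree :=
  match h : t.dest with
  | ⟨.atom a, _⟩ => ⟨NSym.atom a, Fin.elim0⟩
  | ⟨.app, c⟩ => ⟨NSym.app, c⟩
  | ⟨.arr, c⟩ => ⟨NSym.arr, c⟩
  | ⟨.union, _⟩ => ⟨NSym.union t.components.length (Tree.one_lt_components h), t.components.get⟩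

/-- The translation that flattens every maximal union to an `n`-ary union. -/
def Tree.toNTree : Tree → NTree := PFunctor.M.corec Tree.ndest

/-! ### Subtyping up to a set of hypotheses -/

/-- One rule application: the conclusion `A ≤ B`, with premises in `Q`. -/
inductive UpToRule (Q : Set (NTree × NTree)) : NTree → NTree → Prop
  | refl (a : Atom) : UpToRule Q (.atom a) (.atom a)
  | comp {D D' A A'} : (D, D') ∈ Q → (A, A') ∈ Q → UpToRule Q (.app D A) (.app D' A')
  | func {A A' B B'} : (A', A) ∈ Q → (B, B') ∈ Q → UpToRule Q (.arr A B) (.arr A' B')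
  | union {n m : ℕ} (hn : 1 < n) (hm : 1 < m) {A : Fin n → NTree} {B : Fin m → NTree}
      (f : Fin n → Fin m) : (∀ i, (A i, B (f i)) ∈ Q) →
      (∀ i, ¬ (A i).IsUnion) → (∀ j, ¬ (B j).IsUnion) → UpToRule Q (.union n hn A) (.union m hm B)
  | union_l {n : ℕ} (hn : 1 < n) {A : Fin n → NTree} {B : NTree} : (∀ i, (A i, B) ∈ Q) →
      (∀ i, ¬ (A i).IsUnion) → ¬ B.IsUnion → UpToRule Q (.union n hn A) B
  | union_r {m : ℕ} (hm : 1 < m) {A : NTree} {B : Fin m → NTree} (k : Fin m) : (A, B k) ∈ Q →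
      ¬ A.IsUnion → (∀ j, ¬ (B j).IsUnion) → UpToRule Q A (.union m hm B)

theorem UpToRule.mono {Q Q' : Set (NTree × NTree)} (h : Q ⊆ Q') {A B : NTree}
    (hr : UpToRule Q A B) : UpToRule Q' A B := by
  cases hr with
  | refl a => exact .refl a
  | comp h1 h2 => exact .comp (h h1) (h h2)
  | func h1 h2 => exact .func (h h1) (h h2)
  | union hn hm f h1 h2 h3 => exact .union hn hm f (fun i => h (h1 i)) h2 h3
  | union_l hn h1 h2 h3 => exact .union_l hn (fun i => h (h1 i)) h2 h3
  | union_r hm k h1 h2 h3 => exact .union_r hm k (h h1) h2 h3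

/-- The generating function of the subtyping relation up to `R`. -/
def upToFun (R : Set (NTree × NTree)) : Set (NTree × NTree) →o Set (NTree × NTree) where
  toFun S := {p | UpToRule (S ∪ R) p.1 p.2}
  monotone' _ _ h _ hp := UpToRule.mono (Set.union_subset_union_left R h) hp

/-- The subtyping relation up to `R`: the rules are read coinductively. -/
def SubUpTo (R : Set (NTree × NTree)) (A B : NTree) : Prop := (A, B) ∈ (upToFun R).gfp

end MuTypes

/-! Both sides of the equivalence are compared with a third relation, `TSub Eq`, on the expressions
themselves. Unfolding a contractive type at the root and splitting unions leads to its heads: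
variables, constants, applications and function types (`HeadOf`). `TSub` is the greatest relation in
which every head on the left has a partner on the right with the same root and with arguments
related according to variance.

Trees: the components of the tree of `A` are the trees of the heads of `A` (`exists_components`), so
the rules for trees and the matching of heads simulate each other (`upToRule_tsubTrees`,
`SubUpTo.tsub`).

Soundness: `TSub` is a preorder compatible with all constructors, which leaves two rules to be
justified. The rule `contr` holds because a contractive equation has only one solution
(`TSub.of_solution`). For the subtyping rule of `mu`, a judgement under assumptions is interpreted
in `TSub ρ` for every preorder `ρ` on variables that satisfies them, and `TSub.mu` discharges the
assumption `V ≤ W` by substituting the two recursive types.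

Completeness: up to unfolding a type has finitely many subexpressions (`exists_finite_stepClosed`),
so only finitely many goals can arise. `exists_built` constructs `A'` equivalent to `A` and `B'`
equivalent to `B` along with a derivation of `A' ≤ B'`. Each new goal gets two fresh variables and
the assumption that one is below the other; a goal that recurs is answered by its variables, and a
finished goal is closed under `mu`. The equivalences come from `contr`, by putting for each fresh
variable the expression it stands for. The parity of a fresh variable tells its side, which secures
the side conditions of the rule for `mu`; a goal met again with the sides exchanged is a different
goal. -/

namespace MuTypes

/-! ### Substitution, opening, closing and guardedness -/

namespace PreType

/-- All dangling indices are below `n`. -/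
def LC : ℕ → PreType → Prop
  | n, bvar i => i < n
  | _, fvar _ => True
  | _, const _ => True
  | n, app A B => LC n A ∧ LC n B
  | n, arr A B => LC n A ∧ LC n B
  | n, union A B => LC n A ∧ LC n B
  | n, mu _ A => LC (n + 1) A

/-- Simultaneous substitution for the free variables. -/
def subst (σ : TVar → PreType) : PreType → PreType
  | bvar i => bvar i
  | fvar V => σ V
  | const c => const c
  | app A B => app (subst σ A) (subst σ B)
  | arr A B => arr (subst σ A) (subst σ B)
  | union A B => union (subst σ A) (subst σ B)
  | mu k A => mu k (subst σ A)

/-- Turns the free variable `V` into the variable that is bound `n` binders outside. -/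
def closeAt (V : TVar) : ℕ → PreType → PreType
  | _, bvar i => bvar i
  | n, fvar W => if W = V then bvar n else fvar W
  | _, const c => const c
  | n, app A B => app (closeAt V n A) (closeAt V n B)
  | n, arr A B => arr (closeAt V n A) (closeAt V n B)
  | n, union A B => union (closeAt V n A) (closeAt V n B)
  | n, mu k A => mu k (closeAt V (n + 1) A)

/-- The free variable `V` occurs only under `app` or `arr`, if at all. -/
def TopFree (V : TVar) : PreType → Prop
  | bvar _ => True
  | fvar W => W ≠ V
  | const _ => True
  | app _ _ => True
  | arr _ _ => True
  | union A B => TopFree V A ∧ TopFree V B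
  | mu _ A => TopFree V A

theorem LC.mono {A : PreType} : ∀ {m n}, LC m A → m ≤ n → LC n A := by
  induction A with
  | bvar i => intro m n h hmn; simp only [LC] at *; omega
  | fvar _ => intros; trivial
  | const _ => intros; trivial
  | app _ _ h1 h2 => exact fun h hmn => ⟨h1 h.1 hmn, h2 h.2 hmn⟩
  | arr _ _ h1 h2 => exact fun h hmn => ⟨h1 h.1 hmn, h2 h.2 hmn⟩
  | union _ _ h1 h2 => exact fun h hmn => ⟨h1 h.1 hmn, h2 h.2 hmn⟩
  | mu k A h1 => exact fun h hmn => h1 (m := _ + 1) (n := _ + 1) h (by omega)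

theorem LC.openAt_eq {A U : PreType} : ∀ {n}, LC n A → openAt n U A = A := by
  induction A with
  | bvar i => intro n h; simp only [LC] at h; simp only [openAt, if_neg h.ne]
  | fvar _ => intros; rfl
  | const _ => intros; rfl
  | app _ _ h1 h2 => intro n h; rw [openAt, h1 h.1, h2 h.2]
  | arr _ _ h1 h2 => intro n h; rw [openAt, h1 h.1, h2 h.2]
  | union _ _ h1 h2 => intro n h; rw [openAt, h1 h.1, h2 h.2]
  | mu k A h1 => intro n h; rw [openAt, h1 h]

theorem subst_openAt {σ : TVar → PreType} (hσ : ∀ X, LC 0 (σ X)) (U A : PreType) :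
    ∀ n, (openAt n U A).subst σ = openAt n (U.subst σ) (A.subst σ) := by
  induction A with
  | bvar i =>
    intro n
    simp only [openAt, subst]
    split <;> rfl
  | fvar X => intro n; exact (((hσ X).mono (Nat.zero_le n)).openAt_eq).symm
  | const _ => intros; rfl
  | app _ _ h1 h2 => intro n; simp only [openAt, subst, h1, h2]
  | arr _ _ h1 h2 => intro n; simp only [openAt, subst, h1, h2]
  | union _ _ h1 h2 => intro n; simp only [openAt, subst, h1, h2]
  | mu k A h1 => intro n; simp only [openAt, subst, h1]

theorem subst_inst {σ : TVar → PreType} (hσ : ∀ X, LC 0 (σ X)) (A U : PreType) :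
    (A.inst U).subst σ = (A.subst σ).inst (U.subst σ) :=
  subst_openAt hσ U A 0

theorem subst_congr {σ τ : TVar → PreType} {A : PreType} (h : ∀ X ∈ A.fv, σ X = τ X) :
    A.subst σ = A.subst τ := by
  induction A with
  | bvar i => rfl
  | fvar X => exact h X (Finset.mem_singleton_self X)
  | const _ => rfl
  | app _ _ h1 h2 =>
    rw [subst, h1 fun X hX => h X (Finset.mem_union_left _ hX),
      h2 fun X hX => h X (Finset.mem_union_right _ hX)]; rfl
  | arr _ _ h1 h2 =>
    rw [subst, h1 fun X hX => h X (Finset.mem_union_left _ hX),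
      h2 fun X hX => h X (Finset.mem_union_right _ hX)]; rfl
  | union _ _ h1 h2 =>
    rw [subst, h1 fun X hX => h X (Finset.mem_union_left _ hX),
      h2 fun X hX => h X (Finset.mem_union_right _ hX)]; rfl
  | mu k A h1 => rw [subst, h1 h]; rfl

theorem subst_fvar (A : PreType) : A.subst fvar = A := by
  induction A with
  | bvar i => rfl
  | fvar X => rfl
  | const _ => rfl
  | app _ _ h1 h2 => rw [subst, h1, h2]
  | arr _ _ h1 h2 => rw [subst, h1, h2]
  | union _ _ h1 h2 => rw [subst, h1, h2]
  | mu k A h1 => rw [subst, h1]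

/-- Substitution for one free variable. -/
abbrev subst₁ (A : PreType) (V : TVar) (U : PreType) : PreType :=
  A.subst (Function.update fvar V U)

theorem lc_update {σ : TVar → PreType} (hσ : ∀ X, LC 0 (σ X)) {V : TVar} {U : PreType}
    (hU : LC 0 U) (X : TVar) : LC 0 (Function.update σ V U X) := by
  by_cases h : X = V
  · subst h; simpa using hU
  · simpa [h] using hσ X

theorem lc_update_fvar {V : TVar} {U : PreType} (hU : LC 0 U) (X : TVar) :
    LC 0 (Function.update fvar V U X) :=
  lc_update (σ := fvar) (fun _ => trivial) hU X

theorem subst₁_of_notMem {V : TVar} {U A : PreType} (h : V ∉ A.fv) : A.subst₁ V U = A := by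
  conv_rhs => rw [← subst_fvar A]
  refine subst_congr fun X hX => ?_
  rw [Function.update_of_ne]
  rintro rfl
  exact h hX

/-- Carries statements about a body opened with a fresh name over to its unfolding. -/
theorem subst₁_inst {V : TVar} {U A : PreType} (hU : LC 0 U) (h : V ∉ A.fv) :
    (A.inst (fvar V)).subst₁ V U = A.inst U := by
  rw [subst₁, subst_inst (lc_update_fvar hU), ← subst₁, subst₁_of_notMem h]
  simp [subst]

/-- For a type obtained by closing over `V`, this computes the unfolding after substitution, in the
form needed for the premise of `contr`. -/
theorem openAt_subst_closeAt {σ : TVar → PreType} (hσ : ∀ X, LC 0 (σ X)) (V : TVar)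
    (U A : PreType) : ∀ n, LC n A →
      openAt n U ((closeAt V n A).subst σ) = A.subst (Function.update σ V U) := by
  induction A with
  | bvar i => intro n h; simp only [LC] at h; simp only [closeAt, subst, openAt, if_neg h.ne]
  | fvar X =>
    intro n _
    simp only [closeAt, subst]
    by_cases h : X = V
    · subst h; simp [subst, openAt]
    · simp [h, subst, ((hσ X).mono (Nat.zero_le n)).openAt_eq]
  | const _ => intros; rfl
  | app _ _ h1 h2 => intro n h; simp only [closeAt, openAt, subst, h1 n h.1, h2 n h.2]
  | arr _ _ h1 h2 => intro n h; simp only [closeAt, openAt, subst, h1 n h.1, h2 n h.2]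
  | union _ _ h1 h2 => intro n h; simp only [closeAt, openAt, subst, h1 n h.1, h2 n h.2]
  | mu k A h1 => intro n h; simp only [closeAt, openAt, subst, h1 (n + 1) h]

theorem inst_closeAt {A : PreType} (V : TVar) (h : LC 0 A) :
    (closeAt V 0 A).inst (fvar V) = A := by
  have := openAt_subst_closeAt (σ := fvar) (fun _ => trivial) V (fvar V) A 0 h
  rwa [subst_fvar, Function.update_eq_self, subst_fvar] at this

theorem fv_closeAt (V : TVar) (A : PreType) : ∀ n, (closeAt V n A).fv = A.fv.erase V := by
  induction A with
  | bvar i => intro n; rfl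
  | fvar X =>
    intro n
    simp only [closeAt, fv]
    by_cases h : X = V
    · simp [h, fv]
    · simp only [h, if_false, fv]
      rw [Finset.erase_eq_of_notMem]
      simpa using fun h' : V = X => h h'.symm
  | const _ => intros; rfl
  | app _ _ h1 h2 => intro n; simp only [closeAt, fv, h1, h2, Finset.erase_union_distrib]
  | arr _ _ h1 h2 => intro n; simp only [closeAt, fv, h1, h2, Finset.erase_union_distrib]
  | union _ _ h1 h2 => intro n; simp only [closeAt, fv, h1, h2, Finset.erase_union_distrib]
  | mu k A h1 => intro n; simp only [closeAt, fv, h1]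

theorem fv_openAt_subset (U A : PreType) : ∀ n, (openAt n U A).fv ⊆ A.fv ∪ U.fv := by
  induction A with
  | bvar i =>
    intro n
    simp only [openAt]
    split
    · exact Finset.subset_union_right
    · exact Finset.subset_union_left
  | fvar X => intro n; exact Finset.subset_union_left
  | const _ => intro n; exact Finset.subset_union_left
  | app _ _ h1 h2 =>
    intro n
    rw [openAt, fv, fv, Finset.union_union_distrib_right]
    exact Finset.union_subset_union (h1 n) (h2 n)
  | arr _ _ h1 h2 =>
    intro n
    rw [openAt, fv, fv, Finset.union_union_distrib_right]
    exact Finset.union_subset_union (h1 n) (h2 n)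
  | union _ _ h1 h2 =>
    intro n
    rw [openAt, fv, fv, Finset.union_union_distrib_right]
    exact Finset.union_subset_union (h1 n) (h2 n)
  | mu k A h1 => exact fun n => h1 (n + 1)

theorem fv_inst_mu_subset (k : Kind) (A : PreType) : (A.inst (mu k A)).fv ⊆ A.fv := by
  have := fv_openAt_subset (mu k A) A 0
  rwa [show (mu k A).fv = A.fv from rfl, Finset.union_self] at this

theorem TopFree.of_notMem {V : TVar} {A : PreType} (h : V ∉ A.fv) : TopFree V A := by
  induction A with
  | fvar X => rintro rfl; exact h (Finset.mem_singleton_self _)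
  | union _ _ h1 h2 =>
    simp only [fv, Finset.mem_union, not_or] at h
    exact ⟨h1 h.1, h2 h.2⟩
  | mu k A h1 => exact h1 h
  | _ => trivial

theorem TopFree.openAt {V : TVar} {U A : PreType} (hU : TopFree V U) :
    ∀ n, TopFree V A → TopFree V (openAt n U A) := by
  induction A with
  | bvar i =>
    intro n _
    simp only [PreType.openAt]
    split
    · exact hU
    · trivial
  | union _ _ h1 h2 => exact fun n h => ⟨h1 n h.1, h2 n h.2⟩
  | mu k A h1 => exact fun n h => h1 (n + 1) h
  | fvar X => exact fun n h => h
  | _ => intros; trivial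

theorem TopFree.openAt_fvar {V : TVar} {A : PreType} :
    ∀ n, TopFree V A → Guarded n A → TopFree V (PreType.openAt n (fvar V) A) := by
  induction A with
  | bvar i =>
    intro n _ h
    simp only [Guarded] at h
    simp only [PreType.openAt, if_neg h]
    trivial
  | union _ _ h1 h2 => exact fun n h g => ⟨h1 n h.1 g.1, h2 n h.2 g.2⟩
  | mu k A h1 => exact fun n h => h1 (n + 1) h
  | fvar X => exact fun n h _ => h
  | _ => intros; trivial

/-- Provides the contractiveness of the `mu` types built in the completeness proof. -/
theorem TopFree.guarded_closeAt {V : TVar} {A : PreType} :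
    ∀ n, TopFree V A → Guarded n A → Guarded n (closeAt V n A) := by
  induction A with
  | bvar i => exact fun n _ h => h
  | union _ _ h1 h2 => exact fun n h g => ⟨h1 n h.1 g.1, h2 n h.2 g.2⟩
  | mu k A h1 => exact fun n h => h1 (n + 1) h
  | fvar X =>
    intro n h _
    simp only [closeAt, if_neg (show X ≠ V from h)]
    trivial
  | _ => intros; trivial

theorem guarded_closeAt_of_ne (V : TVar) {A : PreType} :
    ∀ i n, i ≠ n → Guarded i A → Guarded i (closeAt V n A) := by
  induction A with
  | bvar i => exact fun _ _ _ h => h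
  | union _ _ h1 h2 => exact fun i n e g => ⟨h1 i n e g.1, h2 i n e g.2⟩
  | mu k A h1 => exact fun i n e h => h1 (i + 1) (n + 1) (by omega) h
  | fvar X =>
    intro i n e _
    simp only [closeAt]
    split
    · exact e.symm
    · trivial
  | _ => intros; trivial

theorem guarded_subst {σ : TVar → PreType} (hσ : ∀ X n, Guarded n (σ X)) {A : PreType} :
    ∀ i, Guarded i A → Guarded i (A.subst σ) := by
  induction A with
  | bvar i => exact fun _ h => h
  | union _ _ h1 h2 => exact fun i g => ⟨h1 i g.1, h2 i g.2⟩
  | mu k A h1 => exact fun i h => h1 (i + 1) h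
  | fvar X => exact fun i _ => hσ X i
  | _ => intros; trivial

end PreType

open PreType

/-! ### Sorts under substitution and closing -/

theorem HasKind.lc {Γ k A} (h : HasKind Γ k A) : LC Γ.length A := by
  induction h with
  | bvar h => exact (List.getElem?_eq_some_iff.1 h).1
  | fvar V => trivial
  | const c => trivial
  | app _ _ h1 h2 => exact ⟨h1, h2⟩
  | arr _ _ h1 h2 => exact ⟨h1, h2⟩
  | union _ _ h1 h2 => exact ⟨h1, h2⟩
  | mu _ g h1 => exact h1
  | ofData _ h1 => exact h1

theorem HasKind.subst {σ : TVar → PreType} (hσ : ∀ X, HasKind [] X.kind (σ X)) {Γ k A}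
    (h : HasKind Γ k A) : HasKind Γ k (A.subst σ) := by
  induction h with
  | bvar h => exact .bvar h
  | fvar V => exact (hσ V).weaken _
  | const c => exact .const c
  | app _ _ h1 h2 => exact .app h1 h2
  | arr _ _ h1 h2 => exact .arr h1 h2
  | union _ _ h1 h2 => exact .union h1 h2
  | mu _ g h1 =>
    exact .mu h1 (guarded_subst (fun X n => (hσ X).guarded n (Nat.zero_le n)) _ g)
  | ofData _ h1 => exact .ofData h1

theorem HasKind.closeAt (V : TVar) {Γ k A} (h : HasKind Γ k A) :
    HasKind (Γ ++ [V.kind]) k (closeAt V Γ.length A) := by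
  induction h with
  | bvar h => exact HasKind.weaken (.bvar h) _
  | fvar W =>
    simp only [PreType.closeAt]
    split
    · next e => subst e; exact .bvar (by simp)
    · exact .fvar W
  | const c => exact .const c
  | app _ _ h1 h2 => exact .app h1 h2
  | arr _ _ h1 h2 => exact .arr h1 h2
  | union _ _ h1 h2 => exact .union h1 h2
  | mu _ g h1 => exact .mu h1 (guarded_closeAt_of_ne V _ _ (by omega) g)
  | ofData _ h1 => exact .ofData h1

theorem HasKind.mu_closeAt {V : TVar} {A : PreType} (h : HasKind [] V.kind A)
    (hV : TopFree V A) : HasKind [] V.kind (.mu V.kind (PreType.closeAt V 0 A)) :=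
  .mu (h.closeAt V) (hV.guarded_closeAt 0 (h.guarded 0 le_rfl))

theorem HasKind.inst_mu_self {k A} (h : HasKind [] k (PreType.mu k A)) :
    HasKind [] k (A.inst (PreType.mu k A)) :=
  h.mu_inv.1.openAt h [] rfl

theorem exists_notMem_fv (k : Kind) (s : Finset TVar) : ∃ V : TVar, V.kind = k ∧ V ∉ s := by
  obtain ⟨n, hn⟩ := Infinite.exists_notMem_finset (s.image TVar.idx)
  exact ⟨⟨k, n⟩, rfl, fun h => hn (Finset.mem_image_of_mem TVar.idx h)⟩

/-! ### Components -/

/-- `h` is a component of `A` as a maximal union, after unfolding. -/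
inductive HeadOf : PreType → PreType → Prop
  | fvar (V) : HeadOf (fvar V) (fvar V)
  | const (c) : HeadOf (const c) (const c)
  | app (D A) : HeadOf (app D A) (app D A)
  | arr (A B) : HeadOf (arr A B) (arr A B)
  | union_l {A B h} : HeadOf A h → HeadOf (union A B) h
  | union_r {A B h} : HeadOf B h → HeadOf (union A B) h
  | mu {k A h} : HeadOf (A.inst (mu k A)) h → HeadOf (mu k A) h

theorem HeadOf.mu_iff {k A h} : HeadOf (PreType.mu k A) h ↔ HeadOf (A.inst (PreType.mu k A)) h :=
  ⟨fun | .mu h => h, .mu⟩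

theorem HeadOf.union_iff {A B h} : HeadOf (PreType.union A B) h ↔ HeadOf A h ∨ HeadOf B h :=
  ⟨fun | .union_l h => .inl h | .union_r h => .inr h, fun h => h.elim .union_l .union_r⟩

theorem HeadOf.self {A h} (hh : HeadOf A h) : HeadOf h h := by
  induction hh with
  | fvar => exact .fvar _
  | const => exact .const _
  | app => exact .app _ _
  | arr => exact .arr _ _
  | _ => assumption

theorem HeadOf.fv_subset {A h} (hh : HeadOf A h) : h.fv ⊆ A.fv := by
  induction hh with
  | union_l _ ih => exact ih.trans Finset.subset_union_left
  | union_r _ ih => exact ih.trans Finset.subset_union_right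
  | mu _ ih => exact ih.trans (fv_inst_mu_subset _ _)
  | _ => exact subset_rfl

/-- Unfolding cannot bring `V` to the top, since the expression put for the bound variable is the
type itself, where `V` is not at the top either. -/
theorem HeadOf.ne_of_topFree {V A h} (hh : HeadOf A h) : TopFree V A → h ≠ PreType.fvar V := by
  induction hh with
  | fvar X => intro h e; cases e; exact h rfl
  | union_l _ ih => exact fun h => ih h.1
  | union_r _ ih => exact fun h => ih h.2
  | @mu k A h _ ih => exact fun h => ih (TopFree.openAt (U := PreType.mu k A) h 0 h)
  | _ => intro _ e; cases e

/-- The only form in which the soundness proof uses contractiveness. -/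
theorem HeadOf.ne_fvar_inst {V k A h} (hA : IsType (PreType.mu k A)) (hV : V ∉ A.fv)
    (hh : HeadOf (A.inst (PreType.fvar V)) h) : h ≠ PreType.fvar V :=
  hh.ne_of_topFree (TopFree.openAt_fvar 0 (.of_notMem hV) hA.mu_inv.2)

theorem HasKind.union_inv' {Γ k A B} (h : HasKind Γ k (PreType.union A B)) :
    HasKind Γ k A ∧ HasKind Γ k B := by
  generalize e : PreType.union A B = T at h
  induction h with
  | union h1 h2 => cases e; exact ⟨h1, h2⟩
  | ofData _ ih => exact ⟨.ofData (ih e).1, .ofData (ih e).2⟩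
  | _ => cases e

theorem HasKind.mu_inv' {Γ j k A} (h : HasKind Γ j (PreType.mu k A)) :
    HasKind Γ k (PreType.mu k A) ∧ (k = j ∨ j = .type) := by
  generalize e : PreType.mu k A = T at h
  induction h with
  | mu h1 g => cases e; exact ⟨.mu h1 g, .inl rfl⟩
  | ofData _ ih => exact ⟨(ih e).1, .inr rfl⟩
  | _ => cases e

theorem HasKind.inst_mu' {j k A} (h : HasKind [] j (PreType.mu k A)) :
    HasKind [] j (A.inst (PreType.mu k A)) := by
  obtain ⟨h1, rfl | rfl⟩ := h.mu_inv'
  · exact h1.inst_mu_self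
  · exact h1.inst_mu_self.toType

theorem HeadOf.hasKind {A h} (hh : HeadOf A h) : ∀ {k}, HasKind [] k A → HasKind [] k h := by
  induction hh with
  | union_l _ ih => exact fun h => ih h.union_inv'.1
  | union_r _ ih => exact fun h => ih h.union_inv'.2
  | mu _ ih => exact fun h => ih h.inst_mu'
  | _ => exact id

/-- Substitution of closed expressions commutes with unfolding. Hence the unfolding of `C.subst σ`
follows that of `C` until a variable of `C` comes to the top. -/
theorem HeadOf.of_subst {σ : TVar → PreType} (hσ : ∀ X, LC 0 (σ X)) {C h : PreType}
    (hh : HeadOf (C.subst σ) h) :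
    ∃ h0, HeadOf C h0 ∧ ((∃ X, h0 = PreType.fvar X ∧ HeadOf (σ X) h) ∨ h = h0.subst σ) := by
  generalize e : C.subst σ = T at hh
  induction hh generalizing C with
  | fvar V =>
    cases C <;> simp only [PreType.subst, reduceCtorEq] at e
    exact ⟨_, .fvar _, .inl ⟨_, rfl, e ▸ .fvar V⟩⟩
  | const c =>
    cases C <;> simp only [PreType.subst, reduceCtorEq] at e
    · exact ⟨_, .fvar _, .inl ⟨_, rfl, e ▸ .const c⟩⟩
    · exact ⟨_, .const _, .inr e.symm⟩
  | app D A =>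
    cases C <;> simp only [PreType.subst, reduceCtorEq] at e
    · exact ⟨_, .fvar _, .inl ⟨_, rfl, e ▸ .app D A⟩⟩
    · exact ⟨_, .app _ _, .inr e.symm⟩
  | arr D A =>
    cases C <;> simp only [PreType.subst, reduceCtorEq] at e
    · exact ⟨_, .fvar _, .inl ⟨_, rfl, e ▸ .arr D A⟩⟩
    · exact ⟨_, .arr _ _, .inr e.symm⟩
  | union_l h1 ih =>
    cases C <;> simp only [PreType.subst, reduceCtorEq] at e
    · exact ⟨_, .fvar _, .inl ⟨_, rfl, e ▸ .union_l h1⟩⟩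
    · cases e
      obtain ⟨h0, h2, h3⟩ := ih rfl
      exact ⟨h0, .union_l h2, h3⟩
  | union_r h1 ih =>
    cases C <;> simp only [PreType.subst, reduceCtorEq] at e
    · exact ⟨_, .fvar _, .inl ⟨_, rfl, e ▸ .union_r h1⟩⟩
    · cases e
      obtain ⟨h0, h2, h3⟩ := ih rfl
      exact ⟨h0, .union_r h2, h3⟩
  | mu h1 ih =>
    cases C <;> simp only [PreType.subst, reduceCtorEq] at e
    · exact ⟨_, .fvar _, .inl ⟨_, rfl, e ▸ .mu h1⟩⟩
    · cases e
      obtain ⟨h0, h2, h3⟩ := ih (C := PreType.inst _ (PreType.mu _ _)) (subst_inst hσ _ _)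
      exact ⟨h0, .mu h2, h3⟩

theorem HeadOf.subst_trans {σ : TVar → PreType} (hσ : ∀ X, LC 0 (σ X)) {C h0 h : PreType}
    (hh : HeadOf C h0) : HeadOf (h0.subst σ) h → HeadOf (C.subst σ) h := by
  induction hh with
  | union_l _ ih => exact fun h => .union_l (ih h)
  | union_r _ ih => exact fun h => .union_r (ih h)
  | mu _ ih =>
    intro h
    refine .mu ?_
    have := ih h
    rwa [subst_inst hσ] at this
  | _ => exact id

theorem HeadOf.subst₁_self {V U C h0} (hh : HeadOf C h0) (hV : h0 ≠ PreType.fvar V) :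
    HeadOf (h0.subst₁ V U) (h0.subst₁ V U) := by
  induction hh with
  | fvar X =>
    have : X ≠ V := fun e => hV (e ▸ rfl)
    simp only [PreType.subst, Function.update_of_ne this]
    exact .fvar _
  | const => exact .const _
  | app => exact .app _ _
  | arr => exact .arr _ _
  | union_l _ ih => exact ih hV
  | union_r _ ih => exact ih hV
  | mu _ ih => exact ih hV

theorem HeadOf.subst₁ {V U C h0} (hU : LC 0 U) (hh : HeadOf C h0) (hV : h0 ≠ PreType.fvar V) :
    HeadOf (C.subst₁ V U) (h0.subst₁ V U) :=
  hh.subst_trans (lc_update_fvar hU) (hh.subst₁_self hV)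

theorem HeadOf.subst₁_fvar {V U C h} (hU : LC 0 U) (hC : HeadOf C (PreType.fvar V))
    (hh : HeadOf U h) : HeadOf (C.subst₁ V U) h :=
  hC.subst_trans (lc_update_fvar hU) (by simpa [PreType.subst] using hh)

theorem HeadOf.of_subst₁ {V U C h} (hU : LC 0 U) (hh : HeadOf (C.subst₁ V U) h) :
    (HeadOf C (PreType.fvar V) ∧ HeadOf U h) ∨
      ∃ h0, HeadOf C h0 ∧ h0 ≠ PreType.fvar V ∧ h = h0.subst₁ V U := by
  obtain ⟨h0, h1, ⟨X, rfl, h2⟩ | rfl⟩ := hh.of_subst (lc_update_fvar hU)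
  · by_cases e : X = V
    · subst e
      exact .inl ⟨h1, by simpa using h2⟩
    · rw [Function.update_of_ne e] at h2
      cases h2
      exact .inr ⟨_, h1, by simpa using e, by simp [PreType.subst, e]⟩
  · by_cases e : h0 = PreType.fvar V
    · subst e
      refine .inl ⟨h1, ?_⟩
      have h2 := hh.self
      simp only [PreType.subst, Function.update_self] at hh h2 ⊢
      exact h2
    · exact .inr ⟨_, h1, e, rfl⟩

/-! ### Coinductive subtyping of `μ`-types by components -/

/-- The components `h` and `h'` have the same root, or are related variables, and `R` relates
their immediate subterms according to variance. -/
inductive HStep (ρ : TVar → TVar → Prop) (R : PreType → PreType → Prop) :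
    PreType → PreType → Prop
  | fvar {V W} : ρ V W → HStep ρ R (fvar V) (fvar W)
  | const (c) : HStep ρ R (const c) (const c)
  | app {D D' A A'} : R D D' → R A A' → HStep ρ R (app D A) (app D' A')
  | arr {A A' B B'} : R A' A → R B B' → HStep ρ R (arr A B) (arr A' B')

theorem HStep.mono {ρ ρ' : TVar → TVar → Prop} {R R' : PreType → PreType → Prop}
    (hρ : ∀ V W, ρ V W → ρ' V W) (hR : ∀ A B, R A B → R' A B) {h h'} (hs : HStep ρ R h h') :
    HStep ρ' R' h h' := by
  cases hs with
  | fvar h => exact .fvar (hρ _ _ h)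
  | const c => exact .const c
  | app h1 h2 => exact .app (hR _ _ h1) (hR _ _ h2)
  | arr h1 h2 => exact .arr (hR _ _ h1) (hR _ _ h2)

/-- Every component on the left is matched by a component on the right. -/
def Match (ρ : TVar → TVar → Prop) (R : PreType → PreType → Prop) (A B : PreType) : Prop :=
  ∀ h, HeadOf A h → ∃ h', HeadOf B h' ∧ HStep ρ R h h'

/-- The greatest relation that is contained in its `Match`. -/
def TSub (ρ : TVar → TVar → Prop) (A B : PreType) : Prop :=
  ∃ R : PreType → PreType → Prop, (∀ A B, R A B → Match ρ R A B) ∧ R A B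

section TSub

variable {ρ : TVar → TVar → Prop} {A B C A' B' : PreType}

theorem TSub.match (h : TSub ρ A B) : Match ρ (TSub ρ) A B := by
  obtain ⟨R, hR, hAB⟩ := h
  intro h hh
  obtain ⟨h', h1, h2⟩ := hR _ _ hAB h hh
  exact ⟨h', h1, h2.mono (fun _ _ => id) fun A B h => ⟨R, hR, h⟩⟩

theorem Match.tsub (h : Match ρ (TSub ρ) A B) : TSub ρ A B := by
  refine ⟨fun A B => Match ρ (TSub ρ) A B, fun A B h k hk => ?_, h⟩
  obtain ⟨h', h1, h2⟩ := h k hk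
  exact ⟨h', h1, h2.mono (fun _ _ => id) fun _ _ => TSub.match⟩

theorem TSub.mono {ρ' : TVar → TVar → Prop} (hρ : ∀ V W, ρ V W → ρ' V W) (h : TSub ρ A B) :
    TSub ρ' A B := by
  obtain ⟨R, hR, hAB⟩ := h
  refine ⟨R, fun A B h k hk => ?_, hAB⟩
  obtain ⟨h', h1, h2⟩ := hR _ _ h k hk
  exact ⟨h', h1, h2.mono hρ fun _ _ => id⟩

theorem HeadOf.hstep_refl (hρ : ∀ V, ρ V V) {R : PreType → PreType → Prop} (hR : ∀ A, R A A)
    {h} (hh : HeadOf A h) : HStep ρ R h h := by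
  induction hh with
  | fvar V => exact .fvar (hρ V)
  | const c => exact .const c
  | app => exact .app (hR _) (hR _)
  | arr => exact .arr (hR _) (hR _)
  | _ => assumption

theorem TSub.of_heads (hρ : ∀ V, ρ V V) (h : ∀ h, HeadOf A h → HeadOf B h) : TSub ρ A B := by
  have hrefl : ∀ A, TSub ρ A A := fun A =>
    ⟨Eq, fun A _ e h hh => e ▸ ⟨h, hh, hh.hstep_refl hρ fun _ => rfl⟩, rfl⟩
  exact Match.tsub fun k hk => ⟨k, h k hk, hk.hstep_refl hρ hrefl⟩

theorem TSub.refl (hρ : ∀ V, ρ V V) (A) : TSub ρ A A := .of_heads hρ fun _ => id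

/-- Two composition hypotheses are needed because contravariant arguments compose in the opposite
order. -/
theorem HStep.comp (hρ : ∀ U V W, ρ U V → ρ V W → ρ U W) {R S T : PreType → PreType → Prop}
    (hc : ∀ A B C, R A B → S B C → T A C) (hc' : ∀ A B C, S A B → R B C → T A C) {h h' h''}
    (h1 : HStep ρ R h h') (h2 : HStep ρ S h' h'') : HStep ρ T h h'' := by
  cases h1 with
  | fvar h => cases h2 with | fvar h' => exact .fvar (hρ _ _ _ h h')
  | const c => cases h2 with | const => exact .const c
  | app a b => cases h2 with | app a' b' => exact .app (hc _ _ _ a a') (hc _ _ _ b b')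
  | arr a b => cases h2 with | arr a' b' => exact .arr (hc' _ _ _ a' a) (hc _ _ _ b b')

theorem TSub.trans (hρ : ∀ U V W, ρ U V → ρ V W → ρ U W) (h1 : TSub ρ A B) (h2 : TSub ρ B C) :
    TSub ρ A C := by
  refine ⟨fun A C => ∃ B, TSub ρ A B ∧ TSub ρ B C, ?_, B, h1, h2⟩
  rintro A C ⟨B, h1, h2⟩ h hh
  obtain ⟨h', hh', s1⟩ := h1.match h hh
  obtain ⟨h'', hh'', s2⟩ := h2.match h' hh'
  exact ⟨h'', hh'', s1.comp hρ (fun _ B _ a b => ⟨B, a, b⟩) (fun _ B _ a b => ⟨B, a, b⟩) s2⟩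

theorem TSub.app (h1 : TSub ρ A A') (h2 : TSub ρ B B') : TSub ρ (.app A B) (.app A' B') :=
  Match.tsub fun | _, .app _ _ => ⟨_, .app _ _, .app h1 h2⟩

theorem TSub.arr (h1 : TSub ρ A' A) (h2 : TSub ρ B B') : TSub ρ (.arr A B) (.arr A' B') :=
  Match.tsub fun | _, .arr _ _ => ⟨_, .arr _ _, .arr h1 h2⟩

theorem TSub.fvar {V W} (h : ρ V W) : TSub ρ (.fvar V) (.fvar W) :=
  Match.tsub fun | _, .fvar _ => ⟨_, .fvar _, .fvar h⟩

theorem TSub.union_l (h1 : TSub ρ A C) (h2 : TSub ρ B C) : TSub ρ (.union A B) C :=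
  Match.tsub fun | _, .union_l h => h1.match _ h | _, .union_r h => h2.match _ h

theorem TSub.union_r1 (h1 : TSub ρ A B) : TSub ρ A (.union B C) :=
  Match.tsub fun h hh => (h1.match h hh).imp fun _ h => ⟨.union_l h.1, h.2⟩

theorem TSub.union_r2 (h1 : TSub ρ A C) : TSub ρ A (.union B C) :=
  Match.tsub fun h hh => (h1.match h hh).imp fun _ h => ⟨.union_r h.1, h.2⟩

end TSub

/-! ### Soundness of type equivalence -/

/-- Equality of `μ`-types as components are matched in both directions. -/
def TEq (A B : PreType) : Prop := TSub Eq A B ∧ TSub Eq B A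

theorem TSub.trans_eq {A B C} (h1 : TSub Eq A B) (h2 : TSub Eq B C) : TSub Eq A C :=
  h1.trans (fun _ _ _ => Eq.trans) h2

theorem TEq.of_heads {A B} (h : ∀ h, HeadOf A h ↔ HeadOf B h) : TEq A B :=
  ⟨.of_heads (fun _ => rfl) fun k => (h k).1, .of_heads (fun _ => rfl) fun k => (h k).2⟩

theorem TEq.trans {A B C} (h1 : TEq A B) (h2 : TEq B C) : TEq A C :=
  ⟨h1.1.trans_eq h2.1, h2.2.trans_eq h1.2⟩

theorem TEq.symm {A B} (h : TEq A B) : TEq B A := ⟨h.2, h.1⟩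

theorem TSub.subst₁ {V U A B} (hU : LC 0 U) (h : TSub Eq A B) :
    TSub Eq (A.subst₁ V U) (B.subst₁ V U) := by
  -- Equality is included because heads coming from `U` appear unchanged on both sides.
  refine ⟨fun x y => x = y ∨ ∃ A B, TSub Eq A B ∧ x = A.subst₁ V U ∧ y = B.subst₁ V U, ?_,
    .inr ⟨A, B, h, rfl, rfl⟩⟩
  rintro x y (rfl | ⟨A, B, h, rfl, rfl⟩) k hk
  · exact ⟨k, hk, hk.hstep_refl (fun _ => rfl) fun _ => .inl rfl⟩
  · obtain ⟨h1, h2⟩ | ⟨h0, h1, h2, rfl⟩ := hk.of_subst₁ hU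
    · obtain ⟨h', h3, h4⟩ := h.match _ h1
      cases h4 with
      | fvar e =>
        subst e
        exact ⟨k, h3.subst₁_fvar hU h2, h2.hstep_refl (fun _ => rfl) fun _ => .inl rfl⟩
    · obtain ⟨h', h3, h4⟩ := h.match _ h1
      have h5 : h' ≠ .fvar V := by
        rintro rfl
        cases h4 with | fvar e => exact h2 (e ▸ rfl)
      refine ⟨_, h3.subst₁ hU h5, ?_⟩
      cases h4 with
      | @fvar X _ e =>
        subst e
        have : X ≠ V := by simpa using h2
        simp only [PreType.subst, Function.update_of_ne this]
        exact .fvar rfl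
      | const c => exact .const c
      | app a b => exact .app (.inr ⟨_, _, a, rfl, rfl⟩) (.inr ⟨_, _, b, rfl, rfl⟩)
      | arr a b => exact .arr (.inr ⟨_, _, a, rfl, rfl⟩) (.inr ⟨_, _, b, rfl, rfl⟩)

/-- `x` and `y` arise, up to `TSub`, from one expression with two solutions of `V = E` for `V`. -/
def SolutionSim (V : TVar) (E x y : PreType) : Prop :=
  ∃ C P Q : PreType, LC 0 P ∧ LC 0 Q ∧ TEq P (E.subst₁ V P) ∧ TEq Q (E.subst₁ V Q) ∧
    TSub Eq x (C.subst₁ V P) ∧ TSub Eq (C.subst₁ V Q) y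

/-- Two solutions of a contractive equation are equal. -/
theorem TSub.of_solution {V E} (hE : ∀ h, HeadOf E h → h ≠ .fvar V) {P Q} (lP : LC 0 P)
    (lQ : LC 0 Q) (hP : TEq P (E.subst₁ V P)) (hQ : TEq Q (E.subst₁ V Q)) : TSub Eq P Q := by
  have hr := TSub.refl (ρ := Eq) (fun _ => rfl)
  refine ⟨SolutionSim V E, ?_, .fvar V, P, Q, lP, lQ, hP, hQ, ?_, ?_⟩
  · clear hP hQ lP lQ P Q
    rintro x y ⟨C, P, Q, lP, lQ, hP, hQ, hx, hy⟩ h hh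
    -- A head of `C` other than `V` keeps its root when `P` or `Q` is put for `V`, and its arguments
    -- are again expressions with the two solutions put for `V`.
    have key : ∀ C h0 h h', h0 ≠ .fvar V → HeadOf C h0 → HStep Eq (TSub Eq) h (h0.subst₁ V P) →
        HStep Eq (TSub Eq) (h0.subst₁ V Q) h' → HStep Eq (SolutionSim V E) h h' := by
      intro C h0 h h' hV hh s1 s2
      induction hh with
      | fvar X =>
        have : X ≠ V := by simpa using hV
        simp only [PreType.subst, Function.update_of_ne this] at s1 s2
        cases s1 with | fvar e => cases s2 with | fvar e' => exact .fvar (e.trans e')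
      | const c => cases s1 with | const => cases s2 with | const => exact .const c
      | app D A =>
        cases s1 with
        | app a b =>
          cases s2 with
          | app a' b' =>
            exact .app ⟨_, _, _, lP, lQ, hP, hQ, a, a'⟩ ⟨_, _, _, lP, lQ, hP, hQ, b, b'⟩
      | arr D A =>
        cases s1 with
        | arr a b =>
          cases s2 with
          | arr a' b' =>
            -- The contravariant argument exchanges the two solutions; this is why `SolutionSim`
            -- quantifies over them.
            exact .arr ⟨_, _, _, lQ, lP, hQ, hP, a', a⟩ ⟨_, _, _, lP, lQ, hP, hQ, b, b'⟩
      | union_l _ ih => exact ih hV s1 s2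
      | union_r _ ih => exact ih hV s1 s2
      | mu _ ih => exact ih hV s1 s2
    obtain ⟨h1, hh1, s1⟩ := hx.match _ hh
    obtain ⟨h2, h3⟩ | ⟨h0, h2, h3, rfl⟩ := hh1.of_subst₁ lP
    -- Here `V` is a head of `C` and the head comes from `P`. Passing from `P` to `E.subst₁ V P`
    -- exposes a head of `E` other than `V`; the same head of `E` with `Q` for `V` leads back to `Q`
    -- and on to `y`.
    · obtain ⟨h4, hh4, s4⟩ := hP.1.match _ h3
      obtain ⟨h5, -⟩ | ⟨e0, h5, h6, rfl⟩ := hh4.of_subst₁ lP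
      · exact absurd rfl (hE _ h5)
      · obtain ⟨h7, hh7, s7⟩ := hQ.2.match _ (h5.subst₁ lQ h6)
        obtain ⟨h8, hh8, s8⟩ := hy.match _ (h2.subst₁_fvar lQ hh7)
        have htr : ∀ A B C, TSub Eq A B → TSub Eq B C → TSub Eq A C := fun _ _ _ => TSub.trans_eq
        exact ⟨h8, hh8, key _ e0 _ _ h6 h5 (HStep.comp (ρ := Eq) (fun _ _ _ => Eq.trans) htr htr s1 s4)
          (HStep.comp (ρ := Eq) (fun _ _ _ => Eq.trans) htr htr s7 s8)⟩
    · obtain ⟨h7, hh7, s7⟩ := hy.match _ (h2.subst₁ lQ h3)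
      exact ⟨h7, hh7, key _ h0 _ _ h3 h2 s1 s7⟩
  · simpa [PreType.subst] using hr P
  · simpa [PreType.subst] using hr Q

/-- Both sides solve the equation given by the body of `mu k B`, the right one by unfolding. -/
theorem TEq.of_contr {k A B} (hA : LC 0 A) (hB : IsType (.mu k B)) (h : TEq A (B.inst A)) :
    TEq A (.mu k B) := by
  obtain ⟨V, -, hV⟩ := exists_notMem_fv k B.fv
  have lB : LC 0 (.mu k B) := hB.lc
  have hE : ∀ h, HeadOf (B.inst (.fvar V)) h → h ≠ .fvar V := fun h => HeadOf.ne_fvar_inst hB hV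
  have h1 : TEq A ((B.inst (.fvar V)).subst₁ V A) := by rwa [subst₁_inst hA hV]
  have h2 : TEq (.mu k B) ((B.inst (.fvar V)).subst₁ V (.mu k B)) := by
    rw [subst₁_inst lB hV]
    exact .of_heads fun _ => HeadOf.mu_iff
  exact ⟨.of_solution hE hA lB h1 h2, .of_solution hE lB hA h2 h1⟩

theorem TypeEq.tEq {A B} (h : TypeEq A B) : TEq A B := by
  induction h with
  | refl => exact .of_heads fun _ => Iff.rfl
  | trans _ _ h1 h2 => exact h1.trans h2
  | symm _ h1 => exact h1.symm
  | comp _ _ _ _ h1 h2 => exact ⟨.app h1.1 h2.1, .app h1.2 h2.2⟩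
  | func _ _ h1 h2 => exact ⟨.arr h1.2 h2.1, .arr h1.1 h2.2⟩
  | union_idem => exact .of_heads fun _ => by rw [HeadOf.union_iff, or_self]
  | union_comm => exact .of_heads fun _ => by rw [HeadOf.union_iff, HeadOf.union_iff, or_comm]
  | union_assoc => exact .of_heads fun _ => by simp only [HeadOf.union_iff, or_assoc]
  | union _ _ h1 h2 =>
    exact ⟨.union_l (.union_r1 h1.1) (.union_r2 h2.1), .union_l (.union_r1 h1.2) (.union_r2 h2.2)⟩
  | @mu A B V hA hB hVA hVB _ ih =>
    -- By uniqueness it suffices that `mu V.kind A` solves the equation of `B`. This is the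
    -- induction hypothesis with `mu V.kind A` put for `V`.
    refine .of_contr hA.lc hB.toType ?_
    have h1 : TEq (.mu V.kind A) (A.inst (.mu V.kind A)) := .of_heads fun _ => HeadOf.mu_iff
    refine h1.trans ?_
    rw [← subst₁_inst hA.lc hVA, ← subst₁_inst hA.lc hVB]
    exact ⟨ih.1.subst₁ hA.lc, ih.2.subst₁ hA.lc⟩
  | fold => exact .of_heads fun _ => HeadOf.mu_iff
  | contr hA hB _ ih => exact .of_contr hA.lc hB.toType ih

/-! ### Soundness of subtyping -/

/-- The preorder `ρ` with `V` and `W` detached and `V ≤ W` added. -/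
def AddPair (ρ : TVar → TVar → Prop) (V W X Y : TVar) : Prop :=
  X = Y ∨ (X = V ∧ Y = W) ∨ (X ≠ V ∧ X ≠ W ∧ Y ≠ V ∧ Y ≠ W ∧ ρ X Y)

/-- Only `V` is below `V` and only `W` is above `W`, so the added pair composes with nothing but
identities. -/
theorem AddPair.trans {ρ : TVar → TVar → Prop} (hρ : ∀ U V W, ρ U V → ρ V W → ρ U W) {V W}
    (X Y Z) (h1 : AddPair ρ V W X Y) (h2 : AddPair ρ V W Y Z) : AddPair ρ V W X Z := by
  unfold AddPair at *
  have := hρ X Y Z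
  grind

/-- The relation that shows `μV.A ≤ μW.B`, in both polarities: bodies that are related under
`V ≤ W`, with `U` and `U'` for `V` and `W`. -/
def MuSim (ρ : TVar → TVar → Prop) (V W : TVar) (U U' x y : PreType) : Prop :=
  ∃ C E : PreType, W ∉ C.fv ∧ V ∉ E.fv ∧
    ((TSub (AddPair ρ V W) C E ∧ x = C.subst₁ V U ∧ y = E.subst₁ W U') ∨
      (TSub (AddPair ρ V W) E C ∧ x = E.subst₁ W U' ∧ y = C.subst₁ V U))

/-- Contravariant arguments exchange the sides, so both polarities are followed at once. In the
positive one a use of `V ≤ W` is justified by comparing the bodies again. In the negative one `W` on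
the left could be matched only by `W`, which is not free on the right, so the assumption is never
used. -/
theorem TSub.mu {ρ : TVar → TVar → Prop} (hr : ∀ X, ρ X X) {V W A B}
    (hA : IsType (.mu V.kind A)) (hB : IsType (.mu W.kind B)) (hVA : V ∉ A.fv) (hWB : W ∉ B.fv)
    (hW : W ∉ (A.inst (.fvar V)).fv) (hV : V ∉ (B.inst (.fvar W)).fv)
    (h : TSub (AddPair ρ V W) (A.inst (.fvar V)) (B.inst (.fvar W))) :
    TSub ρ (.mu V.kind A) (.mu W.kind B) := by
  have lA : LC 0 (.mu V.kind A) := hA.lc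
  have lB : LC 0 (.mu W.kind B) := hB.lc
  have gA : ∀ h, HeadOf (A.inst (.fvar V)) h → h ≠ .fvar V := fun h => HeadOf.ne_fvar_inst hA hVA
  have gB : ∀ h, HeadOf (B.inst (.fvar W)) h → h ≠ .fvar W := fun h => HeadOf.ne_fvar_inst hB hWB
  have uA : ∀ h, HeadOf (.mu V.kind A) h ↔
      HeadOf ((A.inst (.fvar V)).subst₁ V (.mu V.kind A)) h := fun h => by
    rw [subst₁_inst lA hVA, HeadOf.mu_iff]
  have uB : ∀ h, HeadOf (.mu W.kind B) h ↔
      HeadOf ((B.inst (.fvar W)).subst₁ W (.mu W.kind B)) h := fun h => by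
    rw [subst₁_inst lB hWB, HeadOf.mu_iff]
  have hpos : ∀ a b, HStep (AddPair ρ V W) (TSub (AddPair ρ V W)) a b → a ≠ .fvar V →
      b ≠ .fvar W → W ∉ a.fv → V ∉ b.fv →
      HStep ρ (MuSim ρ V W (.mu V.kind A) (.mu W.kind B)) (a.subst₁ V (.mu V.kind A))
        (b.subst₁ W (.mu W.kind B)) := by
    intro a b hs ha hb ha' hb'
    cases hs with
    | @fvar X Y e =>
      simp only [fv, Finset.mem_singleton, ne_eq, PreType.fvar.injEq] at ha hb ha' hb'
      have hXY : ρ X Y := by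
        rcases e with rfl | ⟨rfl, -⟩ | ⟨-, -, -, -, e⟩
        · exact hr _
        · exact absurd rfl ha
        · exact e
      simp only [PreType.subst, Function.update_of_ne ha, Function.update_of_ne hb]
      exact .fvar hXY
    | const c => exact .const c
    | app a b =>
      simp only [fv, Finset.mem_union, not_or] at ha' hb'
      exact .app ⟨_, _, ha'.1, hb'.1, .inl ⟨a, rfl, rfl⟩⟩ ⟨_, _, ha'.2, hb'.2, .inl ⟨b, rfl, rfl⟩⟩
    | arr a b =>
      simp only [fv, Finset.mem_union, not_or] at ha' hb'
      exact .arr ⟨_, _, ha'.1, hb'.1, .inr ⟨a, rfl, rfl⟩⟩ ⟨_, _, ha'.2, hb'.2, .inl ⟨b, rfl, rfl⟩⟩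
  have hneg : ∀ a b, HStep (AddPair ρ V W) (TSub (AddPair ρ V W)) a b → a ≠ .fvar W →
      b ≠ .fvar V → V ∉ a.fv → W ∉ b.fv →
      HStep ρ (MuSim ρ V W (.mu V.kind A) (.mu W.kind B)) (a.subst₁ W (.mu W.kind B))
        (b.subst₁ V (.mu V.kind A)) := by
    intro a b hs ha hb ha' hb'
    cases hs with
    | @fvar X Y e =>
      simp only [fv, Finset.mem_singleton, ne_eq, PreType.fvar.injEq] at ha hb ha' hb'
      have hXY : ρ X Y := by
        rcases e with rfl | ⟨rfl, -⟩ | ⟨-, -, -, -, e⟩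
        · exact hr _
        · exact absurd rfl ha'
        · exact e
      simp only [PreType.subst, Function.update_of_ne ha, Function.update_of_ne hb]
      exact .fvar hXY
    | const c => exact .const c
    | app a b =>
      simp only [fv, Finset.mem_union, not_or] at ha' hb'
      exact .app ⟨_, _, hb'.1, ha'.1, .inr ⟨a, rfl, rfl⟩⟩ ⟨_, _, hb'.2, ha'.2, .inr ⟨b, rfl, rfl⟩⟩
    | arr a b =>
      simp only [fv, Finset.mem_union, not_or] at ha' hb'
      exact .arr ⟨_, _, hb'.1, ha'.1, .inl ⟨a, rfl, rfl⟩⟩ ⟨_, _, hb'.2, ha'.2, .inr ⟨b, rfl, rfl⟩⟩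
  suffices hs : TSub ρ ((A.inst (.fvar V)).subst₁ V (.mu V.kind A))
      ((B.inst (.fvar W)).subst₁ W (.mu W.kind B)) by
    refine Match.tsub fun k hk => ?_
    obtain ⟨k', h1, h2⟩ := hs.match k ((uA k).1 hk)
    exact ⟨k', (uB k').2 h1, h2⟩
  refine ⟨MuSim ρ V W (.mu V.kind A) (.mu W.kind B), ?_, A.inst (.fvar V), B.inst (.fvar W), hW, hV,
    .inl ⟨h, rfl, rfl⟩⟩
  rintro x y ⟨C, E, hC, hE, ⟨hCE, rfl, rfl⟩ | ⟨hCE, rfl, rfl⟩⟩ k hk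
  · obtain ⟨h1, h2⟩ | ⟨h0, h1, h2, rfl⟩ := hk.of_subst₁ lA
    · obtain ⟨e, h3, h4⟩ := hCE.match _ h1
      generalize ev : PreType.fvar V = v at h4
      cases h4 with
      | @fvar X Y r =>
        cases ev
        have hY : Y ≠ V := by rintro rfl; exact hE (h3.fv_subset (Finset.mem_singleton_self _))
        obtain rfl | ⟨-, rfl⟩ | r := r
        · exact absurd rfl hY
        -- The assumption `V ≤ W` was used, so `k` is a head of `mu V.kind A`. By contractiveness it
        -- stems from a head of the opened body other than `V`, and `h` finds its partner in the
        -- other body.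
        · obtain ⟨h5, -⟩ | ⟨a0, h5, h6, rfl⟩ := ((uA k).1 h2).of_subst₁ lA
          · exact absurd rfl (gA _ h5)
          · obtain ⟨b0, h7, h8⟩ := h.match _ h5
            exact ⟨_, h3.subst₁_fvar lB ((uB _).2 (h7.subst₁ lB (gB _ h7))),
              hpos _ _ h8 h6 (gB _ h7) (fun m => hW (h5.fv_subset m))
                (fun m => hV (h7.fv_subset m))⟩
        · exact absurd rfl r.1
      | _ => cases ev
    · obtain ⟨e, h3, h4⟩ := hCE.match _ h1
      have hC0 : W ∉ h0.fv := fun m => hC (h1.fv_subset m)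
      have hE0 : V ∉ e.fv := fun m => hE (h3.fv_subset m)
      -- Only `V` and `W` are below `W`; `h2` excludes the first and `hC0` the second.
      have he : e ≠ .fvar W := by
        rintro rfl
        generalize ev : PreType.fvar W = v at h4
        cases h4 with
        | @fvar X Y r =>
          cases ev
          simp only [fv, Finset.mem_singleton, ne_eq, PreType.fvar.injEq] at h2 hC0
          obtain rfl | ⟨rfl, -⟩ | r := r
          · exact hC0 rfl
          · exact h2 rfl
          · exact r.2.2.2.1 rfl
        | _ => cases ev
      exact ⟨_, h3.subst₁ lB he, hpos _ _ h4 h2 he hC0 hE0⟩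
  · obtain ⟨h1, h2⟩ | ⟨h0, h1, h2, rfl⟩ := hk.of_subst₁ lB
    -- Only `W` is above `W`, and `W` is not free in `C`.
    · exfalso
      obtain ⟨e, h3, h4⟩ := hCE.match _ h1
      have hE0 : V ∉ (PreType.fvar W).fv := fun m => hE (h1.fv_subset m)
      have hC0 : W ∉ e.fv := fun m => hC (h3.fv_subset m)
      generalize ev : PreType.fvar W = v at h4
      cases h4 with
      | @fvar X Y r =>
        cases ev
        simp only [fv, Finset.mem_singleton] at hE0 hC0
        obtain rfl | ⟨rfl, -⟩ | r := r
        · exact hC0 rfl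
        · exact hE0 rfl
        · exact r.2.1 rfl
      | _ => cases ev
    · obtain ⟨e, h3, h4⟩ := hCE.match _ h1
      have hE0 : V ∉ h0.fv := fun m => hE (h1.fv_subset m)
      have hC0 : W ∉ e.fv := fun m => hC (h3.fv_subset m)
      have he : e ≠ .fvar V := by
        rintro rfl
        generalize ev : PreType.fvar V = v at h4
        cases h4 with
        | @fvar X Y r =>
          cases ev
          simp only [fv, Finset.mem_singleton, ne_eq, PreType.fvar.injEq] at h2 hC0 hE0
          obtain rfl | ⟨rfl, -⟩ | r := r
          · exact hE0 rfl
          · exact hE0 rfl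
          · exact r.2.2.1 rfl
        | _ => cases ev
      exact ⟨_, h3.subst₁ lA he, hneg _ _ h4 h2 he hE0 hC0⟩

/-- The quantification over `ρ` lets the induction hypothesis for the bodies be used with `AddPair ρ
V W`. The older assumptions remain valid there because they mention neither `V` nor `W`. -/
theorem Sub.tSub {S A B} (h : Sub S A B) : ∀ ρ : TVar → TVar → Prop, (∀ X, ρ X X) →
    (∀ X Y Z, ρ X Y → ρ Y Z → ρ X Z) → (∀ p ∈ S, ρ p.1 p.2) → TSub ρ A B := by
  induction h with
  | refl => exact fun ρ hr _ _ => .refl hr _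
  | hyp h => exact fun ρ _ _ hS => .fvar (hS _ h)
  | eq h =>
    intro ρ hr _ _
    exact TSub.mono (by rintro V _ rfl; exact hr V) h.tEq.1
  | trans _ _ h1 h2 => exact fun ρ hr ht hS => (h1 ρ hr ht hS).trans ht (h2 ρ hr ht hS)
  | comp _ _ _ _ h1 h2 => exact fun ρ hr ht hS => .app (h1 ρ hr ht hS) (h2 ρ hr ht hS)
  | func _ _ h1 h2 => exact fun ρ hr ht hS => .arr (h1 ρ hr ht hS) (h2 ρ hr ht hS)
  | union_l _ _ h1 h2 => exact fun ρ hr ht hS => .union_l (h1 ρ hr ht hS) (h2 ρ hr ht hS)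
  | union_r1 _ _ h1 => exact fun ρ hr ht hS => .union_r1 (h1 ρ hr ht hS)
  | union_r2 _ _ h1 => exact fun ρ hr ht hS => .union_r2 (h1 ρ hr ht hS)
  | mu V W hA hB hVA hWB hf hW hV _ ih =>
    intro ρ hr ht hS
    refine TSub.mu hr hA.toType hB.toType hVA hWB hW hV
      (ih _ (fun X => .inl rfl) (AddPair.trans ht) ?_)
    rintro p (rfl | hp)
    · exact .inr (.inl ⟨rfl, rfl⟩)
    · have := hf p hp
      exact .inr (.inr ⟨this.1, this.2.2.1, this.2.1, this.2.2.2, hS p hp⟩)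

/-! ### Finitely many subexpressions up to unfolding -/

/-- `B` is an immediate subexpression of `A`, or its unfolding at the root. -/
inductive Step : PreType → PreType → Prop
  | app_l {A B} : Step (app A B) A
  | app_r {A B} : Step (app A B) B
  | arr_l {A B} : Step (arr A B) A
  | arr_r {A B} : Step (arr A B) B
  | union_l {A B} : Step (union A B) A
  | union_r {A B} : Step (union A B) B
  | mu {k A} : Step (mu k A) (A.inst (mu k A))

/-- Closure under immediate subexpressions and unfolding at the root. -/
def StepClosed (S : Set PreType) : Prop := ∀ A ∈ S, ∀ B, Step A B → B ∈ S

theorem StepClosed.head {S : Set PreType} (hS : StepClosed S) {A h} (hh : HeadOf A h) :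
    A ∈ S → h ∈ S := by
  induction hh with
  | union_l _ ih => exact fun h => ih (hS _ h _ .union_l)
  | union_r _ ih => exact fun h => ih (hS _ h _ .union_r)
  | mu _ ih => exact fun h => ih (hS _ h _ .mu)
  | _ => exact id

theorem StepClosed.union {S T : Set PreType} (hS : StepClosed S) (hT : StepClosed T) :
    StepClosed (S ∪ T) := by
  rintro A (h | h) B s
  · exact .inl (hS A h B s)
  · exact .inr (hT A h B s)

theorem StepClosed.insert {S : Set PreType} (hS : StepClosed S) {A}
    (h : ∀ B, Step A B → B ∈ S) : StepClosed (insert A S) := by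
  rintro A (rfl | hA) B s
  · exact .inr (h B s)
  · exact .inr (hS A hA B s)

/-- The number of constructors, not counting leaves. -/
def PreType.size : PreType → ℕ
  | bvar _ => 0
  | fvar _ => 0
  | const _ => 0
  | app A B => size A + size B + 1
  | arr A B => size A + size B + 1
  | union A B => size A + size B + 1
  | mu _ A => size A + 1

theorem PreType.size_openAt_fvar (V : TVar) (A : PreType) :
    ∀ n, (openAt n (fvar V) A).size = A.size := by
  induction A with
  | bvar i => intro n; simp only [openAt]; split <;> rfl
  | fvar _ => intro n; rfl
  | const _ => intro n; rfl
  | app _ _ h1 h2 => intro n; simp only [openAt, size, h1, h2]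
  | arr _ _ h1 h2 => intro n; simp only [openAt, size, h1, h2]
  | union _ _ h1 h2 => intro n; simp only [openAt, size, h1, h2]
  | mu _ _ h1 => intro n; simp only [openAt, size, h1]

theorem lc_openAt {U : PreType} (hU : ∀ n, LC n U) (A : PreType) :
    ∀ n, LC (n + 1) A → LC n (openAt n U A) := by
  induction A with
  | bvar i =>
    intro n h
    simp only [openAt]
    split
    · exact hU n
    · simp only [LC] at *; omega
  | fvar _ => intros; trivial
  | const _ => intros; trivial
  | app _ _ h1 h2 => exact fun n h => ⟨h1 n h.1, h2 n h.2⟩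
  | arr _ _ h1 h2 => exact fun n h => ⟨h1 n h.1, h2 n h.2⟩
  | union _ _ h1 h2 => exact fun n h => ⟨h1 n h.1, h2 n h.2⟩
  | mu _ _ h1 => exact fun n h => h1 (n + 1) h

/-- Induction on size. For `mu k B`, the set for the body opened with a fresh `V` is taken and `mu k
B` is put for `V` throughout. Steps commute with this substitution except at `V` itself, where `mu k
B` appears; its only step is to its unfolding, the image of the opened body. -/
theorem exists_finite_stepClosed (A : PreType) (hA : LC 0 A) :
    ∃ S : Set PreType, S.Finite ∧ StepClosed S ∧ A ∈ S := by
  induction hn : A.size using Nat.strong_induction_on generalizing A with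
  | _ n ih =>
    have two : ∀ B C : PreType, LC 0 B → LC 0 C → B.size < n → C.size < n →
        (∀ D, Step A D → D = B ∨ D = C) →
        ∃ S : Set PreType, S.Finite ∧ StepClosed S ∧ A ∈ S := by
      intro B C hB hC nB nC h
      obtain ⟨S, hS, cS, mS⟩ := ih _ nB B hB rfl
      obtain ⟨T, hT, cT, mT⟩ := ih _ nC C hC rfl
      refine ⟨insert A (S ∪ T), (hS.union hT).insert A, (cS.union cT).insert fun D hD => ?_,
        Set.mem_insert _ _⟩
      obtain rfl | rfl := h D hD
      · exact .inl mS
      · exact .inr mT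
    cases A with
    | bvar i => exact absurd hA (Nat.not_lt_zero i)
    | fvar V => exact ⟨{.fvar V}, Set.finite_singleton _, by rintro _ rfl B ⟨⟩, rfl⟩
    | const c => exact ⟨{.const c}, Set.finite_singleton _, by rintro _ rfl B ⟨⟩, rfl⟩
    | app B C =>
      simp only [size] at hn
      exact two B C hA.1 hA.2 (by omega) (by omega) fun | _, .app_l => .inl rfl | _, .app_r => .inr rfl
    | arr B C =>
      simp only [size] at hn
      exact two B C hA.1 hA.2 (by omega) (by omega) fun | _, .arr_l => .inl rfl | _, .arr_r => .inr rfl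
    | union B C =>
      simp only [size] at hn
      exact two B C hA.1 hA.2 (by omega) (by omega)
        fun | _, .union_l => .inl rfl | _, .union_r => .inr rfl
    | mu k B =>
      obtain ⟨V, -, hV⟩ := exists_notMem_fv k B.fv
      simp only [size] at hn
      obtain ⟨S, hS, cS, mS⟩ := ih (B.inst (.fvar V)).size
        (by rw [inst, size_openAt_fvar]; omega) (B.inst (.fvar V))
        (lc_openAt (U := .fvar V) (fun _ => trivial) B 0 hA) rfl
      have hU : B.inst (.mu k B) ∈ (fun C : PreType => C.subst₁ V (.mu k B)) '' S :=
        ⟨_, mS, subst₁_inst hA hV⟩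
      refine ⟨insert (.mu k B) ((fun C => C.subst₁ V (.mu k B)) '' S), (hS.image _).insert _, ?_,
        Set.mem_insert _ _⟩
      rintro D (rfl | ⟨C, hC, rfl⟩) E hE
      · cases hE
        exact .inr hU
      · right
        cases C with
        | bvar i => cases hE
        | fvar X =>
          simp only [subst] at hE
          by_cases e : X = V
          · subst e
            rw [Function.update_self] at hE
            cases hE
            exact hU
          · rw [Function.update_of_ne e] at hE
            cases hE
        | const c => cases hE
        | app C1 C2 =>
          cases hE with
          | app_l => exact ⟨_, cS _ hC _ .app_l, rfl⟩
          | app_r => exact ⟨_, cS _ hC _ .app_r, rfl⟩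
        | arr C1 C2 =>
          cases hE with
          | arr_l => exact ⟨_, cS _ hC _ .arr_l, rfl⟩
          | arr_r => exact ⟨_, cS _ hC _ .arr_r, rfl⟩
        | union C1 C2 =>
          cases hE with
          | union_l => exact ⟨_, cS _ hC _ .union_l, rfl⟩
          | union_r => exact ⟨_, cS _ hC _ .union_r, rfl⟩
        | mu j C1 =>
          cases hE
          exact ⟨_, cS _ hC _ .mu, subst_inst (lc_update_fvar hA) _ _⟩

/-! ### Completeness of subtyping -/

/-- By the union laws a head is absorbed by its type. So one head of `B` may serve as partner of
several heads of `A`, and other heads of `B` may stay without partner. -/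
theorem HeadOf.typeEq_union {A h} (hh : HeadOf A h) : IsType A → TypeEq (.union h A) A := by
  induction hh with
  | @union_l A B h hh ih =>
    intro hA
    have tA := hA.union_inv.1
    have tB := hA.union_inv.2
    exact (TypeEq.union_assoc (hh.hasKind tA) tA tB).trans (.union (ih tA) (.refl tB))
  | @union_r A B h hh ih =>
    intro hA
    have tA := hA.union_inv.1
    have tB := hA.union_inv.2
    have th : IsType h := hh.hasKind tB
    refine (TypeEq.union (.refl th) (.union_comm tA tB)).trans ?_
    refine (TypeEq.union_assoc th tB tA).trans ?_
    exact (TypeEq.union (ih tB) (.refl tA)).trans (.union_comm tB tA)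
  | @mu k A h hh ih =>
    intro hA
    have e := TypeEq.fold hA.mu_inv'.1
    exact ((TypeEq.union (.refl (hh.hasKind hA.inst_mu')) e).trans (ih hA.inst_mu')).trans e.symm
  | _ => exact fun h => .union_idem h

theorem HasKind.app_congr {k D A D' A'} (h : HasKind [] k (PreType.app D A))
    (hD : IsDatatype D') (hA : IsType A') : HasKind [] k (PreType.app D' A') := by
  cases k
  · exact .app hD hA
  · exact .ofData (.app hD hA)

theorem HasKind.arr_eq {Γ k A B} (h : HasKind Γ k (PreType.arr A B)) : k = .type := by
  generalize e : PreType.arr A B = T at h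
  induction h with
  | arr => rfl
  | ofData => rfl
  | _ => cases e

/-- Sorts are part of a goal, and the set of goals has to be finite. -/
instance : Finite Kind := Finite.of_equiv Bool
  ⟨fun b => if b then .data else .type, fun k => k = .data, by decide, fun k => by cases k <;> rfl⟩

/-- A subtyping goal `A ≤ B` between expressions of sorts `j` and `k`; the flag tells the side from
which `A` comes. -/
abbrev Goal : Type := PreType × Kind × PreType × Kind × Bool

/-- The assumptions `S` made for the goals in `T`. The fresh variables have an index at least
`2 * N` and less than `2 * m`, whose parity tells their side; `σ` maps each fresh variable to
the expression for which it was introduced. -/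
structure Trail (N m : ℕ) (T : Set Goal) (S : Set (TVar × TVar)) (σ : TVar → PreType) : Prop where
  le : N ≤ m
  kind : ∀ X, HasKind [] X.kind (σ X)
  low : ∀ X : TVar, X.idx.div2 < N → σ X = .fvar X
  bound : ∀ p ∈ S, p.1.idx.div2 < m ∧ p.2.idx.div2 < m
  mem : ∀ A j B k s, (A, j, B, k, s) ∈ T → ∃ V W, V.kind = j ∧ W.kind = k ∧ (V, W) ∈ S ∧
    σ V = A ∧ σ W = B ∧ V.idx.bodd = s ∧ W.idx.bodd = !s

/-- The pair `A'`, `B'` represents `A`, `B` and is derivably in the subtyping relation. -/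
structure Built (N : ℕ) (S : Set (TVar × TVar)) (σ : TVar → PreType) (j k : Kind) (s : Bool)
    (A B A' B' : PreType) : Prop where
  kind_l : HasKind [] j A'
  kind_r : HasKind [] k B'
  eq_l : TypeEq (A'.subst σ) A
  eq_r : TypeEq (B'.subst σ) B
  fv_l : ∀ X ∈ A'.fv, X.idx.div2 < N ∨ X.idx.bodd = s
  fv_r : ∀ X ∈ B'.fv, X.idx.div2 < N ∨ X.idx.bodd = !s
  sub : Sub S A' B'

/-- Like `Built`, but `B'` only represents a part of `B`, and both expressions are guarded. -/
structure BuiltBody (N : ℕ) (S : Set (TVar × TVar)) (σ : TVar → PreType) (j k : Kind) (s : Bool)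
    (V W : TVar) (A B A' B' : PreType) : Prop where
  kind_l : HasKind [] j A'
  kind_r : HasKind [] k B'
  eq_l : TypeEq (A'.subst σ) A
  eq_r : TypeEq (.union (B'.subst σ) B) B
  fv_l : ∀ X ∈ A'.fv, X.idx.div2 < N ∨ X.idx.bodd = s
  fv_r : ∀ X ∈ B'.fv, X.idx.div2 < N ∨ X.idx.bodd = !s
  sub : Sub S A' B'
  top_l : TopFree V A'
  top_r : TopFree W B'

section

variable {N m : ℕ} {T : Set Goal} {S : Set (TVar × TVar)} {σ : TVar → PreType} {j k : Kind}
  {s : Bool} {V W : TVar} {A B A₁ A₂ X₁ X₂ Y₁ Y₂ : PreType}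

theorem BuiltBody.union (hσ : ∀ X, HasKind [] X.kind (σ X)) (hB : IsType B)
    (h1 : BuiltBody N S σ j k s V W A₁ B X₁ Y₁) (h2 : BuiltBody N S σ j k s V W A₂ B X₂ Y₂) :
    BuiltBody N S σ j k s V W (.union A₁ A₂) B (.union X₁ X₂) (.union Y₁ Y₂) where
  kind_l := h1.kind_l.union h2.kind_l
  kind_r := h1.kind_r.union h2.kind_r
  eq_l := h1.eq_l.union h2.eq_l
  eq_r := by
    have t1 : IsType (Y₁.subst σ) := (h1.kind_r.subst hσ).toType
    have t2 : IsType (Y₂.subst σ) := (h2.kind_r.subst hσ).toType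
    exact (TypeEq.union_assoc t1 t2 hB).symm.trans
      ((TypeEq.union (.refl t1) h2.eq_r).trans h1.eq_r)
  fv_l := fun X hX => (Finset.mem_union.1 hX).elim (h1.fv_l X) (h2.fv_l X)
  fv_r := fun X hX => (Finset.mem_union.1 hX).elim (h1.fv_r X) (h2.fv_r X)
  sub := .union_l (.union_r1 h2.kind_r.toType h1.sub) (.union_r2 h1.kind_r.toType h2.sub)
  top_l := ⟨h1.top_l, h2.top_l⟩
  top_r := ⟨h1.top_r, h2.top_r⟩

/-- Unions are rebuilt on both sides and unfoldings at the root are undone by `fold`, so that only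
heads are left to be treated. -/
theorem BuiltBody.of_heads (hσ : ∀ X, HasKind [] X.kind (σ X)) (hB : IsType B) (hA : IsType A)
    (h : ∀ h, HeadOf A h → ∃ X Y, BuiltBody N S σ j k s V W h B X Y) :
    ∃ X Y, BuiltBody N S σ j k s V W A B X Y := by
  induction hn : A.topDepth using Nat.strong_induction_on generalizing A with
  | _ n ih =>
    cases A with
    | bvar i => exact absurd hA not_isType_bvar
    | fvar X => exact h _ (.fvar X)
    | const c => exact h _ (.const c)
    | app D A => exact h _ (.app D A)
    | arr A A' => exact h _ (.arr A A')
    | union A₁ A₂ =>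
      simp only [topDepth] at hn
      obtain ⟨X₁, Y₁, h1⟩ := ih _ (by omega) hA.union_inv.1 (fun k hk => h k (.union_l hk)) rfl
      obtain ⟨X₂, Y₂, h2⟩ := ih _ (by omega) hA.union_inv.2 (fun k hk => h k (.union_r hk)) rfl
      exact ⟨_, _, h1.union hσ hB h2⟩
    | mu i A =>
      have := topDepth_openAt (.mu i A) A 0 hA.mu_inv.2
      simp only [topDepth] at hn
      obtain ⟨X, Y, h1⟩ := ih _ (by omega) hA.inst_mu' (fun k hk => h k (.mu hk)) this
      exact ⟨X, Y, { h1 with eq_l := h1.eq_l.trans (TypeEq.fold hA.mu_inv'.1).symm }⟩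

/-- Both new variables have `div2` equal to `m`, larger than for every variable in `S`; the lowest
bit distinguishes the two. -/
theorem Trail.extend (hT : Trail N m T S σ) (hA : HasKind [] j A) (hB : HasKind [] k B)
    (s : Bool) :
    Trail N (m + 1) (insert (A, j, B, k, s) T)
      (insert (⟨j, Nat.bit s m⟩, ⟨k, Nat.bit (!s) m⟩) S)
      (Function.update (Function.update σ ⟨j, Nat.bit s m⟩ A) ⟨k, Nat.bit (!s) m⟩ B) := by
  have hVW : (⟨j, Nat.bit s m⟩ : TVar) ≠ ⟨k, Nat.bit (!s) m⟩ := by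
    intro e
    have := congrArg (fun X : TVar => X.idx.bodd) e
    simp at this
  have hne : ∀ X : TVar, X.idx.div2 < m →
      Function.update (Function.update σ ⟨j, Nat.bit s m⟩ A) ⟨k, Nat.bit (!s) m⟩ B X = σ X := by
    intro X hX
    rw [Function.update_of_ne, Function.update_of_ne]
    all_goals
      rintro rfl
      simp at hX
  refine ⟨hT.le.trans (Nat.le_succ m), fun X => ?_, fun X hX => ?_, ?_, ?_⟩
  · by_cases e : X = ⟨k, Nat.bit (!s) m⟩
    · subst e; simpa using hB
    · rw [Function.update_of_ne e]
      by_cases e : X = ⟨j, Nat.bit s m⟩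
      · subst e; simpa using hA
      · rw [Function.update_of_ne e]
        exact hT.kind X
  · rw [hne X (hX.trans_le hT.le), hT.low X hX]
  · rintro p (rfl | hp)
    · simp
    · have := hT.bound p hp
      omega
  · rintro A' j' B' k' s' (e | h)
    · cases e
      exact ⟨_, _, rfl, rfl, Set.mem_insert _ _, by simp [hVW], by simp, by simp, by simp⟩
    · obtain ⟨V, W, h1, h2, h3, h4, h5, h6⟩ := hT.mem _ _ _ _ _ h
      have := hT.bound _ h3
      exact ⟨V, W, h1, h2, .inr h3, by rw [hne V this.1, h4], by rw [hne W this.2, h5], h6⟩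

/-- Closing a guarded pair under `mu`. -/
theorem BuiltBody.mu (hT : Trail N m T S σ) (hA : HasKind [] j A) (hB : HasKind [] k B)
    (hNB : ∀ X ∈ B.fv, X.idx.div2 < N)
    (h : BuiltBody N (insert (⟨j, Nat.bit s m⟩, ⟨k, Nat.bit (!s) m⟩) S)
      (Function.update (Function.update σ ⟨j, Nat.bit s m⟩ A) ⟨k, Nat.bit (!s) m⟩ B) j k s
      ⟨j, Nat.bit s m⟩ ⟨k, Nat.bit (!s) m⟩ A B X₁ Y₁) :
    ∃ A' B', Built N S σ j k s A B A' B' := by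
  have hT' := hT.extend hA hB s
  have lσ : ∀ X, LC 0 (σ X) := fun X => (hT.kind X).lc
  have hle := hT.le
  have hBσ : B.subst (Function.update (Function.update σ ⟨j, Nat.bit s m⟩ A)
      ⟨k, Nat.bit (!s) m⟩ B) = B := by
    conv_rhs => rw [← subst_fvar B]
    exact subst_congr fun X hX => hT'.low X (hNB X hX)
  generalize hV : (⟨j, Nat.bit s m⟩ : TVar) = V at *
  generalize hW : (⟨k, Nat.bit (!s) m⟩ : TVar) = W at *
  have Vk : V.kind = j := by rw [← hV]
  have Wk : W.kind = k := by rw [← hW]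
  have Vd : V.idx.div2 = m := by rw [← hV]; simp
  have Wd : W.idx.div2 = m := by rw [← hW]; simp
  have Vb : V.idx.bodd = s := by rw [← hV]; simp
  have Wb : W.idx.bodd = !s := by rw [← hW]; simp
  clear hV hW
  subst Vk Wk
  -- `Y₁` represents only the heads of `B` that were used, so `B` is added to make the right side
  -- equivalent to all of `B`. It contains no fresh variable.
  set Z := PreType.union Y₁ B with hZ
  have kZ : HasKind [] W.kind Z := h.kind_r.union hB
  have fZ : ∀ X ∈ Z.fv, X.idx.div2 < N ∨ X.idx.bodd = !s := fun X hX =>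
    (Finset.mem_union.1 hX).elim (h.fv_r X) fun hX => .inl (hNB X hX)
  -- Parity enters here: a fresh variable in `X₁` has parity `s`, that of `W` is the opposite. The
  -- same argument keeps `V` out of `Z`.
  have hWX : W ∉ X₁.fv := fun hm => by
    have := h.fv_l W hm
    rw [Wb, Wd] at this
    cases s <;> simp at this <;> omega
  have hVZ : V ∉ Z.fv := fun hm => by
    have := fZ V hm
    rw [Vb, Vd] at this
    cases s <;> simp at this <;> omega
  have hWB : W ∉ B.fv := fun hm => by
    have := hNB W hm
    omega
  have k1 := h.kind_l.mu_closeAt h.top_l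
  have k2 := kZ.mu_closeAt (V := W) ⟨h.top_r, .of_notMem hWB⟩
  have e1 : X₁.subst (Function.update (Function.update σ V A) W B) =
      X₁.subst (Function.update σ V A) := subst_congr fun X hX => by
    rw [Function.update_of_ne]
    rintro rfl
    exact hWX hX
  have e2 : Z.subst (Function.update (Function.update σ V A) W B) =
      Z.subst (Function.update σ W B) := subst_congr fun X hX => by
    by_cases e : X = W
    · subst e; simp
    · rw [Function.update_of_ne e, Function.update_of_ne e, Function.update_of_ne]
      rintro rfl
      exact hVZ hX
  refine ⟨_, _, k1, k2, ?_, ?_, ?_, ?_, ?_⟩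
  -- Putting `A` for `V` in the body gives an expression equivalent to `A`, which is the premise of
  -- `contr`. The right side is analogous.
  · refine TypeEq.symm (.contr hA (k1.subst hT.kind) ?_)
    rw [inst, openAt_subst_closeAt lσ V A X₁ 0 h.kind_l.lc, ← e1]
    exact h.eq_l.symm
  · refine TypeEq.symm (.contr hB (k2.subst hT.kind) ?_)
    rw [inst, openAt_subst_closeAt lσ W B Z 0 kZ.lc, ← e2, hZ, subst, hBσ]
    exact h.eq_r.symm
  · intro X hX
    rw [fv, fv_closeAt] at hX
    exact h.fv_l X (Finset.mem_of_mem_erase hX)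
  · intro X hX
    rw [fv, fv_closeAt] at hX
    exact fZ X (Finset.mem_of_mem_erase hX)
  · refine .mu V W k1 k2 ?_ ?_ ?_ ?_ ?_ ?_
    · simp [fv_closeAt]
    · simp [fv_closeAt]
    · intro p hp
      have := hT.bound p hp
      refine ⟨?_, ?_, ?_, ?_⟩ <;> (intro e; rw [e] at this; omega)
    · rwa [inst_closeAt V h.kind_l.lc]
    · rwa [inst_closeAt W kZ.lc]
    · rw [inst_closeAt V h.kind_l.lc, inst_closeAt W kZ.lc]
      exact .union_r1 hB.toType h.sub

end

/-- The inductive step of `exists_built`: one root of the goal, given the subgoals. -/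
theorem exists_builtBody_head {N m : ℕ} {T : Set Goal} {S : Set (TVar × TVar)}
    {σ : TVar → PreType} (hT : Trail N (m + 1) T S σ) (hNm : N ≤ m)
    {F : Set PreType} (cF : StepClosed F) (hF : ∀ A ∈ F, ∀ X ∈ A.fv, X.idx.div2 < N)
    (ih : ∀ A ∈ F, ∀ B ∈ F, ∀ j k s, HasKind [] j A → HasKind [] k B → TSub Eq A B →
      ∃ A' B', Built N S σ j k s A B A' B')
    {j k : Kind} {s : Bool} {V W : TVar} (hV : V.idx.div2 = m) (hW : W.idx.div2 = m)
    {B h h' : PreType} (kB : IsType B) (hB : HeadOf B h') (hh : h ∈ F) (hh' : h' ∈ F)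
    (kh : HasKind [] j h) (kh' : HasKind [] k h') (hs : HStep Eq (TSub Eq) h h') :
    ∃ X Y, BuiltBody N S σ j k s V W h B X Y := by
  have absorb : ∀ Y, TypeEq Y h' → TypeEq (.union Y B) B := fun Y e =>
    (TypeEq.union e (.refl kB)).trans (hB.typeEq_union kB)
  cases hs with
  | @fvar X _ e =>
    subst e
    have hX := hF _ hh X (Finset.mem_singleton_self X)
    have e : (PreType.fvar X).subst σ = .fvar X := hT.low X hX
    have hl : ∀ Y ∈ (PreType.fvar X).fv, Y.idx.div2 < N := hF _ hh
    refine ⟨.fvar X, .fvar X, kh, kh', ?_, ?_, fun Y hY => .inl (hl Y hY),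
      fun Y hY => .inl (hl Y hY), .refl kh.toType, ?_, ?_⟩
    · rw [e]; exact .refl kh.toType
    · rw [e]; exact absorb _ (.refl kh.toType)
    · rintro rfl; omega
    · rintro rfl; omega
  | const c =>
    refine ⟨.const c, .const c, kh, kh', .refl kh.toType, absorb _ (.refl kh.toType), ?_, ?_,
      .refl kh.toType, trivial, trivial⟩ <;> simp [fv]
  | @app D D' A A' h1 h2 =>
    obtain ⟨X, Y, b1⟩ := ih D (cF _ hh _ .app_l) D' (cF _ hh' _ .app_l) .data .data s
      kh.app_inv.1 kh'.app_inv.1 h1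
    obtain ⟨X', Y', b2⟩ := ih A (cF _ hh _ .app_r) A' (cF _ hh' _ .app_r) .type .type s
      kh.app_inv.2 kh'.app_inv.2 h2
    refine ⟨.app X X', .app Y Y', kh.app_congr b1.kind_l b2.kind_l,
      kh'.app_congr b1.kind_r b2.kind_r, ?_, absorb _ ?_, ?_, ?_, ?_, trivial, trivial⟩
    · exact .comp (b1.kind_l.subst hT.kind) kh.app_inv.1 b1.eq_l b2.eq_l
    · exact .comp (b1.kind_r.subst hT.kind) kh'.app_inv.1 b1.eq_r b2.eq_r
    · exact fun X hX => (Finset.mem_union.1 hX).elim (b1.fv_l X) (b2.fv_l X)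
    · exact fun X hX => (Finset.mem_union.1 hX).elim (b1.fv_r X) (b2.fv_r X)
    · exact .comp b1.kind_l b1.kind_r b1.sub b2.sub
  | @arr A A' C C' h1 h2 =>
    obtain rfl := kh.arr_eq
    obtain rfl := kh'.arr_eq
    -- The arguments exchange sides and the flag is negated with them, so fresh variables keep the
    -- parity of the side they originally belong to.
    obtain ⟨X, Y, b1⟩ := ih A' (cF _ hh' _ .arr_l) A (cF _ hh _ .arr_l) .type .type (!s)
      kh'.arr_inv.1 kh.arr_inv.1 h1
    obtain ⟨X', Y', b2⟩ := ih C (cF _ hh _ .arr_r) C' (cF _ hh' _ .arr_r) .type .type s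
      kh.arr_inv.2 kh'.arr_inv.2 h2
    have b1r := b1.fv_r
    rw [Bool.not_not] at b1r
    refine ⟨.arr Y X', .arr X Y', .arr b1.kind_r b2.kind_l, .arr b1.kind_l b2.kind_r,
      .func b1.eq_r b2.eq_l, absorb _ (.func b1.eq_l b2.eq_r), ?_, ?_, .func b1.sub b2.sub,
      trivial, trivial⟩
    · exact fun X hX => (Finset.mem_union.1 hX).elim (b1r X) (b2.fv_l X)
    · exact fun X hX => (Finset.mem_union.1 hX).elim (b1.fv_l X) (b2.fv_r X)

/-- Induction on the number of goals over `F` that are not yet assumed. A goal in `T` is answered by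
its two variables. A new goal is added to `T`, its heads are treated under the new assumption, and
the result is closed under `mu`. -/
theorem exists_built {N : ℕ} {F : Set PreType} (fF : F.Finite) (cF : StepClosed F)
    (hF : ∀ A ∈ F, ∀ X ∈ A.fv, X.idx.div2 < N) (n : ℕ) :
    ∀ (T : Set Goal) (m : ℕ) (S : Set (TVar × TVar)) (σ : TVar → PreType), Trail N m T S σ →
      ({g : Goal | g.1 ∈ F ∧ g.2.2.1 ∈ F} \ T).ncard = n →
      ∀ A ∈ F, ∀ B ∈ F, ∀ j k s, HasKind [] j A → HasKind [] k B → TSub Eq A B →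
        ∃ A' B', Built N S σ j k s A B A' B' := by
  induction n using Nat.strong_induction_on with
  | _ n ih =>
    intro T m S σ hT hn A hA B hB j k s kA kB hAB
    by_cases hg : (A, j, B, k, s) ∈ T
    · obtain ⟨V, W, rfl, rfl, h3, rfl, rfl, rfl, h7⟩ := hT.mem _ _ _ _ _ hg
      refine ⟨.fvar V, .fvar W, .fvar V, .fvar W, .refl kA.toType, .refl kB.toType, ?_, ?_, .hyp h3⟩
      · intro X hX
        obtain rfl := Finset.mem_singleton.1 hX
        exact .inr rfl
      · intro X hX
        obtain rfl := Finset.mem_singleton.1 hX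
        exact .inr h7
    · have hT' := hT.extend kA kB s
      have fin : {g : Goal | g.1 ∈ F ∧ g.2.2.1 ∈ F}.Finite := by
        refine (fF.prod (Set.finite_univ.prod (fF.prod
          (Set.finite_univ (α := Kind × Bool))))).subset ?_
        rintro ⟨A, j, B, k, s⟩ ⟨h1, h2⟩
        exact ⟨h1, trivial, h2, trivial⟩
      have hlt : ({g : Goal | g.1 ∈ F ∧ g.2.2.1 ∈ F} \ insert (A, j, B, k, s) T).ncard < n := by
        rw [← hn]
        refine Set.ncard_lt_ncard ⟨Set.sdiff_subset_sdiff_right (Set.subset_insert _ _), fun h => ?_⟩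
          (fin.sdiff)
        exact (h (show (A, j, B, k, s) ∈ _ from ⟨⟨hA, hB⟩, hg⟩)).2 (Set.mem_insert _ _)
      have ih' := ih _ hlt _ _ _ _ hT' rfl
      obtain ⟨X, Y, hXY⟩ := BuiltBody.of_heads (j := j) (k := k) (s := s)
        (V := ⟨j, Nat.bit s m⟩) (W := ⟨k, Nat.bit (!s) m⟩) hT'.kind kB.toType kA.toType
        fun h hh => by
          obtain ⟨h', hh', hs⟩ := hAB.match h hh
          exact exists_builtBody_head hT' hT.le cF hF ih' (by simp) (by simp) kB.toType hh'
            (cF.head hh hA) (cF.head hh' hB) (hh.hasKind kA) (hh'.hasKind kB) hs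
      exact hXY.mu hT kA kB (hF B hB)

theorem TSub.sub {A B} (hA : IsType A) (hB : IsType B) (h : TSub Eq A B) : Sub ∅ A B := by
  obtain ⟨F₁, f1, c1, m1⟩ := exists_finite_stepClosed A hA.lc
  obtain ⟨F₂, f2, c2, m2⟩ := exists_finite_stepClosed B hB.lc
  have fF := f1.union f2
  -- `N` bounds `div2` of the index of every variable in the two finite sets, so indices from `2 *
  -- (N + 1)` on are fresh.
  obtain ⟨N, hN⟩ := (fF.biUnion fun X _ =>
    (X.fv.finite_toSet.image fun V : TVar => V.idx.div2)).bddAbove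
  have hF : ∀ X ∈ F₁ ∪ F₂, ∀ V ∈ X.fv, V.idx.div2 < N + 1 := fun X hX V hV =>
    Nat.lt_succ_of_le (hN (Set.mem_biUnion hX ⟨V, hV, rfl⟩))
  have hT : Trail (N + 1) (N + 1) ∅ ∅ PreType.fvar :=
    ⟨le_rfl, .fvar, fun _ _ => rfl, by simp, by simp⟩
  obtain ⟨A', B', b⟩ := exists_built fF (c1.union c2) hF _ ∅ _ ∅ _ hT rfl A (.inl m1) B (.inr m2)
    .type .type true hA hB h
  have e1 := b.eq_l
  have e2 := b.eq_r
  -- Without assumptions `σ` is the identity, so `A'` and `B'` are themselves equivalent to `A` and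
  -- `B`.
  rw [subst_fvar] at e1 e2
  exact (Sub.eq e1.symm).trans (b.sub.trans (.eq e2))

/-! ### Components of the unfolding -/

namespace Tree

theorem components_of_union {t : Tree} {c : Fin 2 → Tree} (h : t.dest = ⟨Sym.union, c⟩) :
    t.components = (c 0).components ++ (c 1).components := by
  rw [Tree.components]
  split
  · next c' h' =>
    rw [h] at h'
    cases h'
    rfl
  all_goals next h' => rw [h] at h'; cases h'

theorem components_of_ne {t : Tree} (h : t.dest.1 ≠ Sym.union) : t.components = [t] := by
  rw [Tree.components]
  split
  · next c' h' => exact absurd (congrArg Sigma.fst h') h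
  all_goals rfl

theorem dest_toNTree (t : Tree) :
    t.toNTree.dest = ⟨t.ndest.1, fun i => (t.ndest.2 i).toNTree⟩ :=
  PFunctor.M.dest_corec _ _

theorem toNTree_eq {t : Tree} {a : NSym} {c : Fin a.arity → Tree} (h : t.ndest = ⟨a, c⟩) :
    t.toNTree = PFunctor.M.mk (F := NSig) ⟨a, fun i => (c i).toNTree⟩ := by
  rw [← PFunctor.M.mk_dest t.toNTree, dest_toNTree, h]

theorem val_injective : Function.Injective Tree.val := by
  rintro ⟨s, _⟩ ⟨t, _⟩ h
  cases h
  rfl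

theorem dest_eq {t : Tree} {a : Sym} {c : Fin a.arity → Tree}
    (h : t.1.dest = ⟨a, fun i => (c i).1⟩) : t.dest = ⟨a, c⟩ := by
  have key : ∀ x y : Sig Tree, (⟨x.1, fun i => (x.2 i).1⟩ : Sig Sig.M) = ⟨y.1, fun i => (y.2 i).1⟩ →
      x = y := by
    rintro ⟨a, c⟩ ⟨b, d⟩ e
    obtain ⟨rfl, e⟩ := Sigma.mk.inj e
    refine congrArg (Sigma.mk a) (funext fun i => val_injective ?_)
    exact congrFun (eq_of_heq e) i
  exact key _ _ h

theorem ndest_atom {t : Tree} {a c} (h : t.dest = ⟨Sym.atom a, c⟩) :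
    t.ndest = ⟨NSym.atom a, Fin.elim0⟩ := by
  unfold ndest
  split
  all_goals next h' => cases h.symm.trans h' <;> rfl

theorem ndest_app {t : Tree} {c} (h : t.dest = ⟨Sym.app, c⟩) : t.ndest = ⟨NSym.app, c⟩ := by
  unfold ndest
  split
  all_goals next h' => cases h.symm.trans h' <;> rfl

theorem ndest_arr {t : Tree} {c} (h : t.dest = ⟨Sym.arr, c⟩) : t.ndest = ⟨NSym.arr, c⟩ := by
  unfold ndest
  split
  all_goals next h' => cases h.symm.trans h' <;> rfl

theorem ndest_union {t : Tree} {c} (h : t.dest = ⟨Sym.union, c⟩) :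
    t.ndest = ⟨NSym.union t.components.length (one_lt_components h), t.components.get⟩ := by
  unfold ndest
  split
  all_goals first | rfl | next h' => cases h.symm.trans h'

end Tree

/-! ### Constructors of trees with `n`-ary unions -/

namespace NTree

theorem isUnion_union {n hn A} : (union n hn A).IsUnion :=
  ⟨n, hn, rfl⟩

theorem not_isUnion_mk {a : NSym} {c : Fin a.arity → NTree} (h : ∀ n hn, a ≠ .union n hn) :
    ¬ IsUnion (PFunctor.M.mk (F := NSig) ⟨a, c⟩) := by
  rintro ⟨n, hn, e⟩
  exact h n hn e

theorem not_isUnion_atom (a : Atom) : ¬ (atom a).IsUnion := not_isUnion_mk (by simp)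
theorem not_isUnion_app (A B : NTree) : ¬ (app A B).IsUnion := not_isUnion_mk (by simp)
theorem not_isUnion_arr (A B : NTree) : ¬ (arr A B).IsUnion := not_isUnion_mk (by simp)

theorem app_inj {A B A' B' : NTree} (h : app A B = app A' B') : A = A' ∧ B = B' := by
  have := eq_of_heq (Sigma.mk.inj (PFunctor.M.mk_inj h)).2
  exact ⟨congrFun this (0 : Fin 2), congrFun this (1 : Fin 2)⟩

theorem arr_inj {A B A' B' : NTree} (h : arr A B = arr A' B') : A = A' ∧ B = B' := by
  have := eq_of_heq (Sigma.mk.inj (PFunctor.M.mk_inj h)).2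
  exact ⟨congrFun this (0 : Fin 2), congrFun this (1 : Fin 2)⟩

theorem atom_inj {a b : Atom} (h : atom a = atom b) : a = b :=
  NSym.atom.inj (Sigma.mk.inj (PFunctor.M.mk_inj h)).1

theorem atom_ne_app {a A B} : atom a ≠ app A B := fun h => by
  cases (Sigma.mk.inj (PFunctor.M.mk_inj h)).1

theorem atom_ne_arr {a A B} : atom a ≠ arr A B := fun h => by
  cases (Sigma.mk.inj (PFunctor.M.mk_inj h)).1

theorem app_ne_arr {A B A' B'} : app A B ≠ arr A' B' := fun h => by
  cases (Sigma.mk.inj (PFunctor.M.mk_inj h)).1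

end NTree

/-! ### Inversion of the union rules -/

namespace UpToRule

variable {Q : Set (NTree × NTree)}

theorem union_union_inv {n hn A m hm B}
    (h : UpToRule Q (.union n hn A) (.union m hm B)) (i : Fin n) : ∃ j, (A i, B j) ∈ Q := by
  generalize e1 : NTree.union n hn A = a at h
  generalize e2 : NTree.union m hm B = b at h
  have ha : a.IsUnion := e1 ▸ NTree.isUnion_union
  have hb : b.IsUnion := e2 ▸ NTree.isUnion_union
  cases h with
  | refl => exact absurd ha (NTree.not_isUnion_atom _)
  | comp => exact absurd ha (NTree.not_isUnion_app _ _)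
  | func => exact absurd ha (NTree.not_isUnion_arr _ _)
  | union hn hm f h =>
    cases PFunctor.M.mk_inj e1
    cases PFunctor.M.mk_inj e2
    exact ⟨f i, h i⟩
  | union_l _ _ _ h => exact absurd hb h
  | union_r _ _ _ h => exact absurd ha h

theorem union_left_inv {n hn A b} (h : UpToRule Q (.union n hn A) b) (hb : ¬ b.IsUnion)
    (i : Fin n) : (A i, b) ∈ Q := by
  generalize e1 : NTree.union n hn A = a at h
  have ha : a.IsUnion := e1 ▸ NTree.isUnion_union
  cases h with
  | refl => exact absurd ha (NTree.not_isUnion_atom _)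
  | comp => exact absurd ha (NTree.not_isUnion_app _ _)
  | func => exact absurd ha (NTree.not_isUnion_arr _ _)
  | union_l _ h _ _ =>
    cases PFunctor.M.mk_inj e1
    exact h i
  | _ => exact absurd NTree.isUnion_union hb

theorem union_right_inv {a m hm B} (h : UpToRule Q a (.union m hm B)) (ha : ¬ a.IsUnion) :
    ∃ j, (a, B j) ∈ Q := by
  generalize e2 : NTree.union m hm B = b at h
  have hb : b.IsUnion := e2 ▸ NTree.isUnion_union
  cases h with
  | refl => exact absurd hb (NTree.not_isUnion_atom _)
  | comp => exact absurd hb (NTree.not_isUnion_app _ _)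
  | func => exact absurd hb (NTree.not_isUnion_arr _ _)
  | union_r _ k h _ _ =>
    cases PFunctor.M.mk_inj e2
    exact ⟨k, h⟩
  | _ => exact absurd NTree.isUnion_union ha

end UpToRule

/-! ### Trees of `μ`-types and their heads -/

namespace MuType

theorem dest_toTree (A : MuType) : A.toTree.dest = ⟨A.dest.1, fun i => (A.dest.2 i).toTree⟩ :=
  Tree.dest_eq A.dest_unfoldM

theorem dest_toTree_eq {A : MuType} {a : Sym} {c : Fin a.arity → MuType} (h : A.dest = ⟨a, c⟩) :
    A.toTree.dest = ⟨a, fun i => (c i).toTree⟩ := by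
  rw [dest_toTree, h]

theorem toTree_mu {k A} (h : IsType (.mu k A)) :
    toTree ⟨.mu k A, h⟩ = toTree ⟨A.inst (.mu k A), h.inst_mu⟩ :=
  Tree.val_injective (unfoldM_mu h)

/-- The translation of a `μ`-type to a tree with `n`-ary unions. -/
abbrev ntree (A : MuType) : NTree := A.toTree.toNTree

theorem ntree_fvar {V} (h : IsType (.fvar V)) : ntree ⟨.fvar V, h⟩ = .atom (.inl V) := by
  refine (Tree.toNTree_eq (Tree.ndest_atom (dest_toTree_eq (by rw [MuType.dest])))).trans ?_
  exact congrArg (fun c => PFunctor.M.mk (F := NSig) ⟨_, c⟩) (funext fun i => Fin.elim0 i)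

theorem ntree_const {c} (h : IsType (.const c)) : ntree ⟨.const c, h⟩ = .atom (.inr c) := by
  refine (Tree.toNTree_eq (Tree.ndest_atom (dest_toTree_eq (by rw [MuType.dest])))).trans ?_
  exact congrArg (fun c => PFunctor.M.mk (F := NSig) ⟨_, c⟩) (funext fun i => Fin.elim0 i)

theorem ntree_app {A B} (h : IsType (.app A B)) :
    ntree ⟨.app A B, h⟩ = .app (ntree ⟨A, .ofData h.app_inv.1⟩) (ntree ⟨B, h.app_inv.2⟩) := by
  refine (Tree.toNTree_eq (Tree.ndest_app (dest_toTree_eq (by rw [MuType.dest])))).trans ?_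
  exact congrArg (fun c => PFunctor.M.mk (F := NSig) ⟨_, c⟩)
    (funext (Fin.forall_fin_two.2 ⟨rfl, rfl⟩))

theorem ntree_arr {A B} (h : IsType (.arr A B)) :
    ntree ⟨.arr A B, h⟩ = .arr (ntree ⟨A, h.arr_inv.1⟩) (ntree ⟨B, h.arr_inv.2⟩) := by
  refine (Tree.toNTree_eq (Tree.ndest_arr (dest_toTree_eq (by rw [MuType.dest])))).trans ?_
  exact congrArg (fun c => PFunctor.M.mk (F := NSig) ⟨_, c⟩)
    (funext (Fin.forall_fin_two.2 ⟨rfl, rfl⟩))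

/-- Unfolding a `mu` leaves the tree unchanged and a union concatenates the lists of components, so
recursion on `topDepth` applies. -/
theorem exists_components (A : MuType) : ∃ l : List MuType,
    A.toTree.components = l.map toTree ∧ ∀ h : MuType, HeadOf A.1 h.1 ↔ h ∈ l := by
  obtain ⟨A, hA⟩ := A
  induction hn : A.topDepth using Nat.strong_induction_on generalizing A with
  | _ n ih =>
    have leaf : (toTree ⟨A, hA⟩).dest.1 ≠ Sym.union → (∀ h, HeadOf A h ↔ h = A) →
        ∃ l : List MuType, (toTree ⟨A, hA⟩).components = l.map toTree ∧
          ∀ h : MuType, HeadOf A h.1 ↔ h ∈ l := by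
      refine fun h1 h2 => ⟨[⟨A, hA⟩], Tree.components_of_ne h1, fun h => ?_⟩
      rw [h2, List.mem_singleton]
      exact ⟨fun e => by cases h; cases e; rfl, fun e => by rw [e]⟩
    cases A with
    | bvar i => exact absurd hA not_isType_bvar
    | fvar X =>
      refine leaf ?_ fun h => ⟨fun | .fvar _ => rfl, fun e => e ▸ .fvar _⟩
      rw [dest_toTree, MuType.dest]
      exact nofun
    | const X =>
      refine leaf ?_ fun h => ⟨fun | .const _ => rfl, fun e => e ▸ .const _⟩
      rw [dest_toTree, MuType.dest]
      exact nofun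
    | app D A =>
      refine leaf ?_ fun h => ⟨fun | .app _ _ => rfl, fun e => e ▸ .app _ _⟩
      rw [dest_toTree, MuType.dest]
      exact nofun
    | arr D A =>
      refine leaf ?_ fun h => ⟨fun | .arr _ _ => rfl, fun e => e ▸ .arr _ _⟩
      rw [dest_toTree, MuType.dest]
      exact nofun
    | union A B =>
      simp only [topDepth] at hn
      obtain ⟨l₁, h1, h2⟩ := ih _ (by omega) A hA.union_inv.1 rfl
      obtain ⟨l₂, h3, h4⟩ := ih _ (by omega) B hA.union_inv.2 rfl
      refine ⟨l₁ ++ l₂, ?_, fun h => ?_⟩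
      · rw [Tree.components_of_union (dest_toTree_eq (by rw [MuType.dest])), List.map_append]
        exact congrArg₂ _ h1 h3
      · rw [HeadOf.union_iff, List.mem_append, ← h2, ← h4]
    | mu k A =>
      simp only [topDepth] at hn
      obtain ⟨l, h1, h2⟩ := ih _ (by omega) (A.inst (.mu k A)) hA.inst_mu
        (topDepth_openAt (.mu k A) A 0 hA.mu_inv.2)
      exact ⟨l, by rw [toTree_mu, h1], fun h => by rw [HeadOf.mu_iff, ← h2]⟩

/-- Reduces the union rules to heads: the children of a union node are the trees of all heads, and a
type whose tree has no union at the root has a single head. -/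
theorem ntree_cases (A : MuType) :
    (∃ h : MuType, A.ntree = h.ntree ∧ ∀ k : MuType, HeadOf A.1 k.1 ↔ k = h) ∨
    ∃ n hn, ∃ f : Fin n → MuType, A.ntree = .union n hn (fun i => (f i).ntree) ∧
      ∀ k : MuType, HeadOf A.1 k.1 ↔ ∃ i, f i = k := by
  obtain ⟨l, h1, h2⟩ := A.exists_components
  by_cases h : A.toTree.dest.1 = Sym.union
  · right
    obtain ⟨c, hc⟩ : ∃ c : Fin 2 → Tree, A.toTree.dest = ⟨Sym.union, c⟩ := by
      generalize A.toTree.dest = x at h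
      obtain ⟨a, c⟩ := x
      cases h
      exact ⟨c, rfl⟩
    have hl : A.toTree.components.length = l.length := by rw [h1, List.length_map]
    refine ⟨_, Tree.one_lt_components hc, fun i => l.get (i.cast hl), ?_, fun k => ?_⟩
    · refine (Tree.toNTree_eq (Tree.ndest_union hc)).trans ?_
      refine congrArg (fun c => PFunctor.M.mk (F := NSig) ⟨_, c⟩) (funext fun i => ?_)
      refine congrArg Tree.toNTree ?_
      refine Eq.trans (b := (l.map toTree).get ⟨i.1, by rw [← h1]; exact i.2⟩) ?_ (by simp; rfl)
      exact List.get_of_eq h1 i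
    · rw [h2, List.mem_iff_get]
      exact ⟨fun ⟨i, e⟩ => ⟨i.cast hl.symm, e⟩, fun ⟨i, e⟩ => ⟨_, e⟩⟩
  · left
    rw [Tree.components_of_ne h] at h1
    obtain ⟨h, rfl, e⟩ := List.map_eq_singleton_iff.1 h1.symm
    exact ⟨h, congrArg Tree.toNTree e.symm, fun k => by rw [h2, List.mem_singleton]⟩

end MuType

/-! ### Rule applications between components -/

/-- Atoms, applications and function types. -/
inductive IsHead : PreType → Prop
  | fvar (V) : IsHead (fvar V)
  | const (c) : IsHead (const c)
  | app (D A) : IsHead (app D A)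
  | arr (A B) : IsHead (arr A B)

theorem HeadOf.isHead {A h} (hh : HeadOf A h) : IsHead h := by
  induction hh with
  | fvar => exact .fvar _
  | const => exact .const _
  | app => exact .app _ _
  | arr => exact .arr _ _
  | _ => assumption

/-- The relation on `μ`-types that `Q` induces via their trees. -/
def TreeRel (Q : Set (NTree × NTree)) (A B : PreType) : Prop :=
  ∃ hA hB, (MuType.ntree ⟨A, hA⟩, MuType.ntree ⟨B, hB⟩) ∈ Q

section

variable {h k : PreType} {Q : Set (NTree × NTree)}

theorem IsHead.not_isUnion (hh : IsHead h) (t : IsType h) : ¬ (MuType.ntree ⟨h, t⟩).IsUnion := by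
  cases hh with
  | fvar => rw [MuType.ntree_fvar]; exact NTree.not_isUnion_atom _
  | const => rw [MuType.ntree_const]; exact NTree.not_isUnion_atom _
  | app => rw [MuType.ntree_app]; exact NTree.not_isUnion_app _ _
  | arr => rw [MuType.ntree_arr]; exact NTree.not_isUnion_arr _ _

theorem IsHead.of_atom (hh : IsHead h) {t : IsType h} {a} (e : NTree.atom a = MuType.ntree ⟨h, t⟩) :
    (∃ V, h = .fvar V ∧ a = .inl V) ∨ ∃ c, h = .const c ∧ a = .inr c := by
  cases hh with
  | fvar V => rw [MuType.ntree_fvar] at e; exact .inl ⟨V, rfl, NTree.atom_inj e⟩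
  | const c => rw [MuType.ntree_const] at e; exact .inr ⟨c, rfl, NTree.atom_inj e⟩
  | app => rw [MuType.ntree_app] at e; exact absurd e NTree.atom_ne_app
  | arr => rw [MuType.ntree_arr] at e; exact absurd e NTree.atom_ne_arr

theorem IsHead.of_app (hh : IsHead h) {t : IsType h} {x y}
    (e : NTree.app x y = MuType.ntree ⟨h, t⟩) :
    ∃ A B tA tB, h = .app A B ∧ x = MuType.ntree ⟨A, tA⟩ ∧ y = MuType.ntree ⟨B, tB⟩ := by
  cases hh with
  | fvar V => rw [MuType.ntree_fvar] at e; exact absurd e.symm NTree.atom_ne_app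
  | const c => rw [MuType.ntree_const] at e; exact absurd e.symm NTree.atom_ne_app
  | app A B =>
    rw [MuType.ntree_app] at e
    exact ⟨A, B, _, _, rfl, (NTree.app_inj e).1, (NTree.app_inj e).2⟩
  | arr => rw [MuType.ntree_arr] at e; exact absurd e NTree.app_ne_arr

theorem IsHead.of_arr (hh : IsHead h) {t : IsType h} {x y}
    (e : NTree.arr x y = MuType.ntree ⟨h, t⟩) :
    ∃ A B tA tB, h = .arr A B ∧ x = MuType.ntree ⟨A, tA⟩ ∧ y = MuType.ntree ⟨B, tB⟩ := by
  cases hh with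
  | fvar V => rw [MuType.ntree_fvar] at e; exact absurd e.symm NTree.atom_ne_arr
  | const c => rw [MuType.ntree_const] at e; exact absurd e.symm NTree.atom_ne_arr
  | arr A B =>
    rw [MuType.ntree_arr] at e
    exact ⟨A, B, _, _, rfl, (NTree.arr_inj e).1, (NTree.arr_inj e).2⟩
  | app => rw [MuType.ntree_app] at e; exact absurd e.symm NTree.app_ne_arr

theorem HStep.upToRule (hs : HStep Eq (TreeRel Q) h k) (th : IsType h) (tk : IsType k) :
    UpToRule Q (MuType.ntree ⟨h, th⟩) (MuType.ntree ⟨k, tk⟩) := by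
  cases hs with
  | fvar e => subst e; rw [MuType.ntree_fvar]; exact .refl _
  | const c => rw [MuType.ntree_const]; exact .refl _
  | app h1 h2 =>
    rw [MuType.ntree_app, MuType.ntree_app]
    exact .comp h1.2.2 h2.2.2
  | arr h1 h2 =>
    rw [MuType.ntree_arr, MuType.ntree_arr]
    exact .func h1.2.2 h2.2.2

/-- Trees of heads have no union at the root, which leaves only the rules `refl`, `comp` and `func`.
-/
theorem UpToRule.hStep (hh : IsHead h) (hk : IsHead k) {th : IsType h} {tk : IsType k}
    (hr : UpToRule Q (MuType.ntree ⟨h, th⟩) (MuType.ntree ⟨k, tk⟩)) :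
    HStep Eq (TreeRel Q) h k := by
  have uh := hh.not_isUnion th
  have uk := hk.not_isUnion tk
  generalize e1 : MuType.ntree ⟨h, th⟩ = a at hr uh
  generalize e2 : MuType.ntree ⟨k, tk⟩ = b at hr uk
  cases hr with
  | refl a =>
    obtain ⟨V, rfl, rfl⟩ | ⟨c, rfl, rfl⟩ := hh.of_atom e1.symm
    · obtain ⟨W, rfl, e⟩ | ⟨c, rfl, e⟩ := hk.of_atom e2.symm
      · exact .fvar (Sum.inl.inj e)
      · cases e
    · obtain ⟨W, rfl, e⟩ | ⟨c, rfl, e⟩ := hk.of_atom e2.symm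
      · cases e
      · cases e
        exact .const _
  | comp h1 h2 =>
    obtain ⟨A, B, tA, tB, rfl, rfl, rfl⟩ := hh.of_app e1.symm
    obtain ⟨A', B', tA', tB', rfl, rfl, rfl⟩ := hk.of_app e2.symm
    exact .app ⟨_, _, h1⟩ ⟨_, _, h2⟩
  | func h1 h2 =>
    obtain ⟨A, B, tA, tB, rfl, rfl, rfl⟩ := hh.of_arr e1.symm
    obtain ⟨A', B', tA', tB', rfl, rfl, rfl⟩ := hk.of_arr e2.symm
    exact .arr ⟨_, _, h1⟩ ⟨_, _, h2⟩
  | union_r => exact absurd NTree.isUnion_union uk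
  | _ => exact absurd NTree.isUnion_union uh

theorem HStep.tsub (hk : HeadOf k k) (hh : IsHead h) (hs : HStep Eq (TSub Eq) h k) :
    TSub Eq h k := by
  refine Match.tsub fun h' hh' => ⟨k, hk, ?_⟩
  obtain rfl : h' = h := by cases hh <;> cases hh' <;> rfl
  exact hs

end

/-! ### Tree subtyping is matching of components -/

/-- The pairs of trees of `μ`-types that are in `TSub Eq`. -/
def tsubTrees : Set (NTree × NTree) :=
  {p | ∃ A B : MuType, p = (A.ntree, B.ntree) ∧ TSub Eq A.1 B.1}

theorem upToRule_tsubTrees {A B : MuType} (h : TSub Eq A.1 B.1) :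
    UpToRule tsubTrees A.ntree B.ntree := by
  -- For matched heads, `TSub` supplies the premises of a union rule, and the rule application
  -- settles the case in which neither tree is a union.
  have hmatch : ∀ a : MuType, HeadOf A.1 a.1 → ∃ b : MuType, HeadOf B.1 b.1 ∧ TSub Eq a.1 b.1 ∧
      UpToRule tsubTrees a.ntree b.ntree := by
    intro a ha
    obtain ⟨b, hb, hs⟩ := h.match _ ha
    have tb : IsType b := hb.hasKind B.2
    refine ⟨⟨b, tb⟩, hb, hs.tsub hb.self ha.isHead, HStep.upToRule ?_ a.2 tb⟩
    have ta := a.2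
    generalize a.1 = a' at *
    cases hs with
    | fvar e => exact .fvar e
    | const c => exact .const c
    | app h1 h2 =>
      exact .app ⟨.ofData ta.app_inv.1, .ofData tb.app_inv.1, _, _, rfl, h1⟩
        ⟨ta.app_inv.2, tb.app_inv.2, _, _, rfl, h2⟩
    | arr h1 h2 =>
      exact .arr ⟨tb.arr_inv.1, ta.arr_inv.1, _, _, rfl, h1⟩
        ⟨ta.arr_inv.2, tb.arr_inv.2, _, _, rfl, h2⟩
  obtain ⟨a, eA, hA⟩ | ⟨n, hn, f, eA, hA⟩ := A.ntree_cases
  · have ha := (hA a).2 rfl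
    obtain ⟨b, hb, hs, hr⟩ := hmatch a ha
    obtain ⟨b', eB, hB⟩ | ⟨m, hm, g, eB, hB⟩ := B.ntree_cases
    · rwa [eA, eB, ← (hB b).1 hb]
    · obtain ⟨j, rfl⟩ := (hB b).1 hb
      rw [eA, eB]
      exact .union_r hm j ⟨_, _, rfl, hs⟩ (ha.isHead.not_isUnion a.2)
        fun j => ((hB _).2 ⟨j, rfl⟩).isHead.not_isUnion (g j).2
  · have hf : ∀ i, HeadOf A.1 (f i).1 := fun i => (hA _).2 ⟨i, rfl⟩
    obtain ⟨b', eB, hB⟩ | ⟨m, hm, g, eB, hB⟩ := B.ntree_cases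
    · rw [eA, eB]
      refine .union_l hn (fun i => ?_) (fun i => (hf i).isHead.not_isUnion (f i).2)
        (((hB _).2 rfl).isHead.not_isUnion b'.2)
      obtain ⟨b, hb, hs, -⟩ := hmatch _ (hf i)
      exact ⟨_, _, rfl, (hB b).1 hb ▸ hs⟩
    · have : ∀ i, ∃ j, TSub Eq (f i).1 (g j).1 := fun i => by
        obtain ⟨b, hb, hs, -⟩ := hmatch _ (hf i)
        obtain ⟨j, rfl⟩ := (hB b).1 hb
        exact ⟨j, hs⟩
      choose φ hφ using this
      rw [eA, eB]
      exact .union hn hm φ (fun i => ⟨_, _, rfl, hφ i⟩)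
        (fun i => (hf i).isHead.not_isUnion (f i).2)
        fun j => ((hB _).2 ⟨j, rfl⟩).isHead.not_isUnion (g j).2

theorem TSub.subUpTo {A B : MuType} (h : TSub Eq A.1 B.1) : SubUpTo ∅ A.ntree B.ntree := by
  refine OrderHom.le_gfp (upToFun ∅) (a := tsubTrees) ?_ ⟨A, B, rfl, h⟩
  rintro _ ⟨A, B, rfl, h⟩
  exact (upToRule_tsubTrees h).mono Set.subset_union_left

theorem SubUpTo.upToRule {x y} (h : SubUpTo ∅ x y) :
    UpToRule {p | SubUpTo ∅ p.1 p.2} x y := by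
  unfold SubUpTo at h
  rw [← OrderHom.map_gfp] at h
  exact UpToRule.mono (by rw [Set.union_empty]; exact subset_rfl) h

/-- One `Match` step may take two rule applications: a union rule yields the component on the right,
and its premise, inverted once more, compares two heads. -/
theorem SubUpTo.tsub {A B : MuType} (h : SubUpTo ∅ A.ntree B.ntree) : TSub Eq A.1 B.1 := by
  refine ⟨TreeRel {p | SubUpTo ∅ p.1 p.2}, ?_, A.2, B.2, h⟩
  clear h A B
  rintro A B ⟨tA, tB, h⟩ k hk
  have tk : IsType k := hk.hasKind tA
  have hr := SubUpTo.upToRule h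
  suffices ∃ b : MuType, HeadOf B b.1 ∧
      UpToRule {p | SubUpTo ∅ p.1 p.2} (MuType.ntree ⟨k, tk⟩) b.ntree by
    obtain ⟨b, hb, hs⟩ := this
    exact ⟨b.1, hb, hs.hStep hk.isHead hb.isHead⟩
  have uk := hk.isHead.not_isUnion tk
  obtain ⟨a, eA, hA⟩ | ⟨n, hn, f, eA, hA⟩ := MuType.ntree_cases ⟨A, tA⟩
  · obtain rfl := (hA ⟨k, tk⟩).1 hk
    obtain ⟨b, eB, hB⟩ | ⟨m, hm, g, eB, hB⟩ := MuType.ntree_cases ⟨B, tB⟩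
    · exact ⟨b, (hB b).2 rfl, by rwa [eA, eB] at hr⟩
    · rw [eA, eB] at hr
      obtain ⟨j, hj⟩ := hr.union_right_inv uk
      exact ⟨g j, (hB _).2 ⟨j, rfl⟩, SubUpTo.upToRule hj⟩
  · obtain ⟨i, hi⟩ := (hA ⟨k, tk⟩).1 hk
    rw [← hi]
    obtain ⟨b, eB, hB⟩ | ⟨m, hm, g, eB, hB⟩ := MuType.ntree_cases ⟨B, tB⟩
    · rw [eA, eB] at hr
      have hb := (hB b).2 rfl
      exact ⟨b, hb, SubUpTo.upToRule (hr.union_left_inv (hb.isHead.not_isUnion b.2) i)⟩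
    · rw [eA, eB] at hr
      obtain ⟨j, hj⟩ := hr.union_union_inv i
      exact ⟨g j, (hB _).2 ⟨j, rfl⟩, SubUpTo.upToRule hj⟩

end MuTypes

theorem mainTheorem4 (A B : MuTypes.MuType) :
    MuTypes.MuType.Subtype A B ↔
      MuTypes.SubUpTo ∅ A.toTree.toNTree B.toTree.toNTree :=
  ⟨fun h => (h.tSub Eq (fun _ => rfl) (fun _ _ _ => Eq.trans) (by simp)).subUpTo,
    fun h => h.tsub.sub A.2 B.2⟩
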